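/- All vector spaces are complex. For a vector space $V$ and scalar matrices $\alpha,\beta$ put $(\alpha x\beta)_{ij}=\sum_{k,l}\alpha_{ik}\beta_{lj}x_{kl}$ for $x\in M_n(V)$; scalar matrices carry the operator norm. If $V$ is a $*$-vector space, $M_n(V)$ has the involution $[x_{ij}]^*=[x_{ji}^*]$ and $M_n(V)_{sa}=\{x: x^*=x\}$. An operator space is a vector space $V$ with norms $\|\cdot\|_n$ on $M_n(V)$, $n\in\mathbb N$, such that $\|x\oplus y\|_{m+n}=\max\{\|x\|_m,\|y\|_n\}$ and $\|\alpha x\beta\|_n\le\|\alpha\|\,\|x\|_m\,\|\beta\|$ for $x\in M_m(V)$, $y\in M_n(V)$, $\alpha\in M_{n,m}$, $\beta\in M_{m,n}$. A matrix ordered operator space is an operator space $V$ which is also a $*$-vector space, equipped with (not necessarily proper) cones $M_n(V)^+\subset M_n(V)_{sa}$, such that $\alpha^*M_m(V)^+\alpha\subset M_n(V)^+$ for $\alpha\in M_{m,n}$, the involution is isometric on each $M_n(V)$, and each $M_n(V)^+$ is norm closed. For $x,y\in M_n(V)_{sa}$, $x\le y$ means $y-x\in M_n(V)^+$. The norm of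 $V$ is complete if $(V,\|\cdot\|_1)$ is complete. A linear map $\Phi:V\to W$ between matrix ordered operator spaces has amplifications $\Phi_n:M_n(V)\to M_n(W)$, $[x_{ij}]\mapsto[\Phi(x_{ij})]$. It is completely bounded if $\|\Phi\|_{cb}=\sup_n\|\Phi_n\|<\infty$, and completely positive if $\Phi(v^*)=\Phi(v)^*$ for all $v\in V$ and $\Phi_n(M_n(V)^+)\subset M_n(W)^+$ for all $n$. We say that $V$ is completely isomorphic and complete order isomorphic to $W$ if there is a linear bijection $\Phi:V\to W$ such that both $\Phi$ and $\Phi^{-1}$ are completely bounded and completely positive. The dual $V^*$ (the bounded linear functionals on $V$) of a matrix ordered operator space $V$ has the involution $\varphi^*(v)=\overline{\varphi(v^*)}$; identifying $F=[F_{ij}]\in M_n(V^*)$ with the map $v\mapsto[F_{ij}(v)]$, $V\to M_n$, it has the norm $\|F\|_n=\|F\|_{cb}$ on $M_n(V^*)$ and the cone $M_n(V^*)^+$ of all completely positive $F$. With these, $V^*$ is a matrix ordered operator space. A matrix ordered operator space $V$ with complete norm is matrix regular if for all $n$ and all $v\in M_n(V)_{sa}$: (1) $u\in M_n(V)^+$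 and $-u\le v\le u$ imply $\|v\|_n\le\|u\|_n$; (2) $\|v\|_n<1$ implies that there is $u\in M_n(V)^+$ with $\|u\|_n<1$ and $-u\le v\le u$. A matrix ordered operator space $X$ is a (nonunital, Werner) operator system if its positive cones are proper, i.e. $M_n(X)^+\cap(-M_n(X)^+)=\{0\}$ for all $n$, and there is $k>0$ such that $\|x\|_n\le k\,\nu_X(x)$ for all $n$ and all $x\in M_n(X)$, where $$\nu_X(x)=\sup\left\{\left|\varphi\begin{pmatrix}0&x\\x^*&0\end{pmatrix}\right| : \varphi \text{ a linear functional on } M_{2n}(X),\ \varphi(y^*)=\overline{\varphi(y)},\ \varphi(M_{2n}(X)^+)\subset[0,\infty),\ \|\varphi\|\le 1\right\}.$$ Theorem. Let $V$ be a matrix ordered operator space with complete norm. Then $V$ is completely isomorphic and complete order isomorphic to a matrix regular operator space if and only if both $V$ and its dual $V^*$ are operator systems. -/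

import Mathlib

universe u

open scoped Matrix.Norms.L2Operator ComplexOrder

noncomputable section

namespace MatOrd

section Matrices

variable {V W : Type*} [AddCommGroup V] [Module ℂ V] [AddCommGroup W] [Module ℂ W]

/-- The two-sided product `α x β` of a matrix `x` over `V` with scalar matrices `α`, `β`. -/
def scalarMul {k l m n : ℕ} (α : Matrix (Fin k) (Fin l) ℂ) (x : Matrix (Fin l) (Fin m) V)
    (β : Matrix (Fin m) (Fin n) ℂ) : Matrix (Fin k) (Fin n) V :=
  Matrix.of fun i j => ∑ p, ∑ q, (α i p * β q j) • x p q

/-- The block matrix `(a b; c d)`, with rows and columns indexed by `Fin (m + n)`. -/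
def block {m n : ℕ} (a : Matrix (Fin m) (Fin m) V) (b : Matrix (Fin m) (Fin n) V)
    (c : Matrix (Fin n) (Fin m) V) (d : Matrix (Fin n) (Fin n) V) :
    Matrix (Fin (m + n)) (Fin (m + n)) V :=
  Matrix.reindex finSumFinEquiv finSumFinEquiv (Matrix.fromBlocks a b c d)

end Matrices

/-- The structure of an (abstract) operator space on the complex normed space `V`: a norm
`matNorm n` on each matrix space `M_n(V)`, extending the norm of `V = M_1(V)` and satisfying
Ruan's axioms. Scalar matrices carry the operator norm. -/
class OperatorSpace (V : Type*) [NormedAddCommGroup V] [NormedSpace ℂ V] where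
  matNorm : (n : ℕ) → Matrix (Fin n) (Fin n) V → ℝ
  matNorm_add_le : ∀ (n : ℕ) (x y : Matrix (Fin n) (Fin n) V),
    matNorm n (x + y) ≤ matNorm n x + matNorm n y
  matNorm_smul : ∀ (n : ℕ) (c : ℂ) (x : Matrix (Fin n) (Fin n) V),
    matNorm n (c • x) = ‖c‖ * matNorm n x
  eq_zero_of_matNorm : ∀ (n : ℕ) (x : Matrix (Fin n) (Fin n) V), matNorm n x = 0 → x = 0
  matNorm_one : ∀ v : V, matNorm 1 (Matrix.of fun _ _ => v) = ‖v‖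
  matNorm_directSum : ∀ (m n : ℕ) (x : Matrix (Fin m) (Fin m) V) (y : Matrix (Fin n) (Fin n) V),
    matNorm (m + n) (block x 0 0 y) = max (matNorm m x) (matNorm n y)
  matNorm_scalarMul_le : ∀ (m n : ℕ) (α : Matrix (Fin n) (Fin m) ℂ)
    (x : Matrix (Fin m) (Fin m) V) (β : Matrix (Fin m) (Fin n) ℂ),
    matNorm n (scalarMul α x β) ≤ ‖α‖ * matNorm m x * ‖β‖

/-- The structure of a matrix ordered space on the complex `*`-vector space `V`: a (not
necessarily proper) cone `cone n` of selfadjoint elements in each `M_n(V)`, where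
`(x_ij)^* = (x_ji^*)`, compatible with `x ↦ α^* x α`. -/
class MatrixOrdered (V : Type*) [AddCommGroup V] [Module ℂ V] [StarAddMonoid V]
    [StarModule ℂ V] where
  cone : (n : ℕ) → Set (Matrix (Fin n) (Fin n) V)
  zero_mem_cone : ∀ n : ℕ, (0 : Matrix (Fin n) (Fin n) V) ∈ cone n
  add_mem_cone : ∀ (n : ℕ) (x y : Matrix (Fin n) (Fin n) V),
    x ∈ cone n → y ∈ cone n → x + y ∈ cone n
  smul_mem_cone : ∀ (n : ℕ) (r : ℝ) (x : Matrix (Fin n) (Fin n) V),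
    0 ≤ r → x ∈ cone n → (r : ℂ) • x ∈ cone n
  isHermitian_of_mem_cone : ∀ (n : ℕ) (x : Matrix (Fin n) (Fin n) V),
    x ∈ cone n → x.IsHermitian
  scalarMul_mem_cone : ∀ (m n : ℕ) (α : Matrix (Fin m) (Fin n) ℂ)
    (x : Matrix (Fin m) (Fin m) V), x ∈ cone m → scalarMul α.conjTranspose x α ∈ cone n

/-- Matrix ordered operator spaces: the involution is isometric on every `M_n(V)` and every cone
is closed in the norm of `M_n(V)`. -/
class MatrixOrderedOperatorSpace (V : Type*) [NormedAddCommGroup V] [NormedSpace ℂ V]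
    [StarAddMonoid V] [StarModule ℂ V] extends OperatorSpace V, MatrixOrdered V where
  matNorm_conjTranspose : ∀ (n : ℕ) (x : Matrix (Fin n) (Fin n) V),
    matNorm n x.conjTranspose = matNorm n x
  cone_closed : ∀ (n : ℕ) (x : Matrix (Fin n) (Fin n) V),
    (∀ ε : ℝ, 0 < ε → ∃ y ∈ cone n, matNorm n (x - y) < ε) → x ∈ cone n

open OperatorSpace MatrixOrdered MatrixOrderedOperatorSpace

/-- The space of bounded linear functionals on `V`, with the dual norm. -/
def OpDual (V : Type*) [NormedAddCommGroup V] [NormedSpace ℂ V] : Type _ := StrongDual ℂ V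

section Dual

variable {V : Type*} [NormedAddCommGroup V] [NormedSpace ℂ V]

instance : NormedAddCommGroup (OpDual V) := inferInstanceAs (NormedAddCommGroup (StrongDual ℂ V))

instance : NormedSpace ℂ (OpDual V) := inferInstanceAs (NormedSpace ℂ (StrongDual ℂ V))

instance : FunLike (OpDual V) V ℂ := inferInstanceAs (FunLike (StrongDual ℂ V) V ℂ)

theorem OpDual.ext {φ ψ : OpDual V} (h : ∀ v, φ v = ψ v) : φ = ψ := DFunLike.ext _ _ h

theorem OpDual.map_add (φ : OpDual V) (v w : V) : φ (v + w) = φ v + φ w :=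
  ContinuousLinearMap.map_add (φ : StrongDual ℂ V) v w

theorem OpDual.map_smul (φ : OpDual V) (c : ℂ) (v : V) : φ (c • v) = c * φ v :=
  ContinuousLinearMap.map_smul (φ : StrongDual ℂ V) c v

theorem OpDual.map_sum (φ : OpDual V) {ι : Type*} (s : Finset ι) (f : ι → V) :
    φ (∑ i ∈ s, f i) = ∑ i ∈ s, φ (f i) :=
  let ψ : V →L[ℂ] ℂ := φ
  _root_.map_sum ψ f s

theorem OpDual.map_zero (φ : OpDual V) : φ 0 = 0 :=
  ContinuousLinearMap.map_zero (φ : StrongDual ℂ V)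

theorem OpDual.add_apply (φ ψ : OpDual V) (v : V) : (φ + ψ) v = φ v + ψ v := rfl

theorem OpDual.sub_apply (φ ψ : OpDual V) (v : V) : (φ - ψ) v = φ v - ψ v := rfl

theorem OpDual.smul_apply (c : ℂ) (φ : OpDual V) (v : V) : (c • φ) v = c * φ v := rfl

theorem OpDual.zero_apply (v : V) : (0 : OpDual V) v = 0 := rfl

theorem OpDual.sum_apply {ι : Type*} (s : Finset ι) (f : ι → OpDual V) (v : V) :
    (∑ i ∈ s, f i) v = ∑ i ∈ s, f i v := by
  classical
  induction s using Finset.induction_on with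
  | empty => rfl
  | insert a s ha ih => rw [Finset.sum_insert ha, Finset.sum_insert ha, OpDual.add_apply, ih]

theorem OpDual.norm_apply_le (φ : OpDual V) (v : V) : ‖φ v‖ ≤ ‖φ‖ * ‖v‖ :=
  ContinuousLinearMap.le_opNorm (φ : StrongDual ℂ V) v

theorem OpDual.norm_le {φ : OpDual V} {c : ℝ} (hc : 0 ≤ c) (h : ∀ v, ‖φ v‖ ≤ c * ‖v‖) :
    ‖φ‖ ≤ c :=
  ContinuousLinearMap.opNorm_le_bound (φ : StrongDual ℂ V) hc h

/-- A matrix `F = (F_ij)` over the dual space is identified with the map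
`V → M_n, v ↦ (F_ij(v))`. This is its `m`-th amplification `M_m(V) → M_m(M_n)`, whose values are
regarded as complex matrices indexed by pairs. -/
def amp {m n : ℕ} (F : Matrix (Fin n) (Fin n) (OpDual V)) (x : Matrix (Fin m) (Fin m) V) :
    Matrix (Fin m × Fin n) (Fin m × Fin n) ℂ :=
  Matrix.of fun p q => F p.2 q.2 (x p.1 q.1)

/-- The completely bounded norm of `F ∈ M_n(V^*) = CB(V, M_n)`. -/
def cbNorm [OperatorSpace V] (n : ℕ) (F : Matrix (Fin n) (Fin n) (OpDual V)) : ℝ :=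
  sSup {r : ℝ | ∃ (m : ℕ) (x : Matrix (Fin m) (Fin m) V), matNorm m x ≤ 1 ∧ r = ‖amp F x‖}

end Dual

section DualStar

variable {V : Type*} [NormedAddCommGroup V] [NormedSpace ℂ V] [StarAddMonoid V]
  [StarModule ℂ V] [MatrixOrderedOperatorSpace V]

theorem norm_star_eq (v : V) : ‖star v‖ = ‖v‖ := by
  rw [← matNorm_one v, ← matNorm_one (star v), ← matNorm_conjTranspose 1 (Matrix.of fun _ _ => v)]
  rfl

/-- The involution `φ^*(v) = conj (φ (v^*))` on the dual space. -/
instance : Star (OpDual V) where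
  star φ := LinearMap.mkContinuous (𝕜 := ℂ) (𝕜₂ := ℂ) (E := V) (F := ℂ) (σ := RingHom.id ℂ)
    { toFun := fun v => star (φ (star v))
      map_add' := fun v w => by rw [star_add, OpDual.map_add, star_add]
      map_smul' := fun c v => by
        rw [star_smul, OpDual.map_smul, star_mul', star_star, RingHom.id_apply, smul_eq_mul] }
    ‖φ‖ (fun v => by
      refine (norm_star (φ (star v))).le.trans ((φ.norm_apply_le _).trans ?_)
      rw [norm_star_eq])

theorem OpDual.star_apply (φ : OpDual V) (v : V) : (star φ) v = star (φ (star v)) := rfl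

instance : StarAddMonoid (OpDual V) where
  star_involutive φ := OpDual.ext fun v => by simp [OpDual.star_apply]
  star_add φ ψ := OpDual.ext fun v => by simp [OpDual.star_apply, OpDual.add_apply]

instance : StarModule ℂ (OpDual V) where
  star_smul c φ := OpDual.ext fun v => by simp [OpDual.star_apply, OpDual.smul_apply]

end DualStar

section MatrixLemmas

variable {ι κ : Type*} [Fintype ι] [Fintype κ] [DecidableEq κ]

theorem sum_norm_mulVec_sq_le (A : Matrix ι κ ℂ) (ξ : κ → ℂ) :
    ∑ i, ‖A.mulVec ξ i‖ ^ 2 ≤ ‖A‖ ^ 2 * ∑ j, ‖ξ j‖ ^ 2 := by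
  have h := A.l2_opNorm_mulVec (WithLp.toLp 2 ξ)
  have h2 := pow_le_pow_left₀ (norm_nonneg _) h 2
  rw [mul_pow, EuclideanSpace.norm_sq_eq, EuclideanSpace.norm_sq_eq] at h2
  exact h2

theorem l2_norm_le {A : Matrix ι κ ℂ} {c : ℝ} (hc : 0 ≤ c)
    (h : ∀ ξ : κ → ℂ, ∑ i, ‖A.mulVec ξ i‖ ^ 2 ≤ c ^ 2 * ∑ j, ‖ξ j‖ ^ 2) : ‖A‖ ≤ c := by
  rw [Matrix.l2_opNorm_def]
  refine ContinuousLinearMap.opNorm_le_bound _ hc fun ξ => ?_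
  refine (sq_le_sq₀ (norm_nonneg _) (by positivity)).mp ?_
  rw [mul_pow, EuclideanSpace.norm_sq_eq, EuclideanSpace.norm_sq_eq]
  exact h ξ

open scoped Kronecker in
theorem norm_one_kronecker_le {a b : ℕ} (m : ℕ) (α : Matrix (Fin a) (Fin b) ℂ) :
    ‖(1 : Matrix (Fin m) (Fin m) ℂ) ⊗ₖ α‖ ≤ ‖α‖ := by
  refine l2_norm_le (norm_nonneg _) fun ξ => ?_
  rw [Fintype.sum_prod_type, Fintype.sum_prod_type, Finset.mul_sum]
  refine Finset.sum_le_sum fun i _ => ?_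
  refine le_trans (le_of_eq ?_) (sum_norm_mulVec_sq_le α fun j => ξ (i, j))
  refine Finset.sum_congr rfl fun k _ => ?_
  congr 2
  simp [Matrix.mulVec, dotProduct, Fintype.sum_prod_type, Matrix.kroneckerMap_apply,
    Matrix.one_apply, Finset.sum_ite_irrel, Finset.sum_ite_eq]

theorem norm_col_le {m : ℕ} (ξ : Fin m → ℂ) :
    ‖(Matrix.of fun i _ => ξ i : Matrix (Fin m) (Fin 1) ℂ)‖ ≤ √(∑ i, ‖ξ i‖ ^ 2) := by
  refine l2_norm_le (Real.sqrt_nonneg _) fun η => ?_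
  rw [Real.sq_sqrt (by positivity)]
  simp [Matrix.mulVec, dotProduct, mul_pow, Finset.sum_mul]

end MatrixLemmas

section DualNorm

variable {V : Type*} [NormedAddCommGroup V] [NormedSpace ℂ V]

theorem amp_add {m n : ℕ} (F G : Matrix (Fin n) (Fin n) (OpDual V))
    (x : Matrix (Fin m) (Fin m) V) : amp (F + G) x = amp F x + amp G x := rfl

theorem amp_sub {m n : ℕ} (F G : Matrix (Fin n) (Fin n) (OpDual V))
    (x : Matrix (Fin m) (Fin m) V) : amp (F - G) x = amp F x - amp G x := rfl

theorem amp_smul {m n : ℕ} (c : ℂ) (F : Matrix (Fin n) (Fin n) (OpDual V))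
    (x : Matrix (Fin m) (Fin m) V) : amp (c • F) x = c • amp F x := rfl

theorem amp_smul_right {m n : ℕ} (c : ℂ) (F : Matrix (Fin n) (Fin n) (OpDual V))
    (x : Matrix (Fin m) (Fin m) V) : amp F (c • x) = c • amp F x := by
  ext p q
  exact OpDual.map_smul _ _ _

open scoped Kronecker in
theorem amp_scalarMul {m n k : ℕ} (α : Matrix (Fin k) (Fin n) ℂ)
    (F : Matrix (Fin n) (Fin n) (OpDual V)) (β : Matrix (Fin n) (Fin k) ℂ)
    (x : Matrix (Fin m) (Fin m) V) :
    amp (scalarMul α F β) x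
      = ((1 : Matrix (Fin m) (Fin m) ℂ) ⊗ₖ α) * amp F x
        * ((1 : Matrix (Fin m) (Fin m) ℂ) ⊗ₖ β) := by
  ext ⟨a, i⟩ ⟨b, j⟩
  simp only [amp, scalarMul, Matrix.of_apply, OpDual.sum_apply, OpDual.smul_apply,
    Matrix.mul_apply, Fintype.sum_prod_type, Matrix.kroneckerMap_apply, Matrix.one_apply]
  simp only [ite_mul, one_mul, zero_mul, mul_ite, mul_zero, Finset.sum_mul]
  simp only [Finset.sum_ite_irrel, Finset.sum_const_zero, Finset.sum_ite_eq,
    Finset.sum_ite_eq', Finset.mem_univ, if_true]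
  rw [Finset.sum_comm]
  refine Finset.sum_congr rfl fun q _ => Finset.sum_congr rfl fun p _ => ?_
  ring

variable [OperatorSpace V]

theorem matNorm_zero (n : ℕ) : matNorm n (0 : Matrix (Fin n) (Fin n) V) = 0 := by
  have h := matNorm_smul n 0 (0 : Matrix (Fin n) (Fin n) V)
  simpa using h

theorem matNorm_nonneg (n : ℕ) (x : Matrix (Fin n) (Fin n) V) : 0 ≤ matNorm n x := by
  have h := matNorm_add_le n x ((-1 : ℂ) • x)
  rw [matNorm_smul] at h
  have h0 : x + (-1 : ℂ) • x = 0 := by simp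
  rw [h0, matNorm_zero] at h
  simp at h
  linarith

/-- `F` is completely bounded by `c`. -/
def CBBound {n : ℕ} (F : Matrix (Fin n) (Fin n) (OpDual V)) (c : ℝ) : Prop :=
  ∀ (m : ℕ) (x : Matrix (Fin m) (Fin m) V), ‖amp F x‖ ≤ c * matNorm m x

theorem CBBound.add {n : ℕ} {F G : Matrix (Fin n) (Fin n) (OpDual V)} {c d : ℝ}
    (hF : CBBound F c) (hG : CBBound G d) : CBBound (F + G) (c + d) := fun m x => by
  rw [amp_add, add_mul]
  exact (norm_add_le _ _).trans (add_le_add (hF m x) (hG m x))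

theorem CBBound.scalarMul {n k : ℕ} {F : Matrix (Fin n) (Fin n) (OpDual V)} {c : ℝ}
    (hF : CBBound F c) (α : Matrix (Fin k) (Fin n) ℂ) (β : Matrix (Fin n) (Fin k) ℂ) :
    CBBound (scalarMul α F β) (‖α‖ * c * ‖β‖) := fun m x => by
  rw [amp_scalarMul]
  refine (Matrix.l2_opNorm_mul _ _).trans ?_
  have h1 := (Matrix.l2_opNorm_mul ((1 : Matrix (Fin m) (Fin m) ℂ).kronecker α) (amp F x)).trans
    (mul_le_mul (norm_one_kronecker_le m α) (hF m x) (norm_nonneg _) (norm_nonneg _))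
  refine (mul_le_mul h1 (norm_one_kronecker_le m β) (norm_nonneg _)
    ((norm_nonneg _).trans h1)).trans (le_of_eq ?_)
  ring

theorem cbBound_functional (φ : OpDual V) :
    CBBound (Matrix.of fun _ _ => φ : Matrix (Fin 1) (Fin 1) (OpDual V)) ‖φ‖ := fun m x => by
  set A := amp (Matrix.of fun _ _ => φ : Matrix (Fin 1) (Fin 1) (OpDual V)) x with hA
  have hc : 0 ≤ ‖φ‖ * matNorm m x := mul_nonneg (norm_nonneg _) (matNorm_nonneg m x)
  refine l2_norm_le hc fun ξ => ?_
  set η : Fin m × Fin 1 → ℂ := A.mulVec ξ with hη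
  set S := ∑ i, ‖η i‖ ^ 2 with hS
  set T := ∑ j, ‖ξ j‖ ^ 2 with hT
  have hS0 : 0 ≤ S := by positivity
  have hT0 : 0 ≤ T := by positivity
  let r : Matrix (Fin m) (Fin 1) ℂ := Matrix.of fun i _ => η (i, 0)
  let s : Matrix (Fin m) (Fin 1) ℂ := Matrix.of fun i _ => ξ (i, 0)
  have hr : ‖r‖ ≤ √S := by
    refine (norm_col_le fun i => η (i, 0)).trans (le_of_eq ?_)
    rw [hS, Fintype.sum_prod_type]; simp
  have hs : ‖s‖ ≤ √T := by
    refine (norm_col_le fun i => ξ (i, 0)).trans (le_of_eq ?_)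
    rw [hT, Fintype.sum_prod_type]; simp
  have hrs : ‖r.conjTranspose‖ ≤ √S := by rwa [Matrix.l2_opNorm_conjTranspose]
  let w : V := ∑ p, ∑ q, (star (η (p, 0)) * ξ (q, 0)) • x p q
  have hw : MatOrd.scalarMul r.conjTranspose x s = Matrix.of fun _ _ => w := rfl
  have hwn : ‖w‖ ≤ √S * matNorm m x * √T := by
    rw [← matNorm_one w, ← hw]
    refine (matNorm_scalarMul_le m 1 r.conjTranspose x s).trans ?_
    exact mul_le_mul (mul_le_mul_of_nonneg_right hrs (matNorm_nonneg m x)) hs (norm_nonneg _)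
      (mul_nonneg (Real.sqrt_nonneg _) (matNorm_nonneg m x))
  have hval : φ w = (S : ℂ) := by
    have e : (S : ℂ) = ∑ i, star (η i) * η i := by
      rw [hS]; push_cast
      refine Finset.sum_congr rfl fun i _ => ?_
      exact (Complex.conj_mul' (η i)).symm
    rw [e, Fintype.sum_prod_type]
    simp only [w, OpDual.map_sum, OpDual.map_smul, Finset.univ_unique, Finset.sum_singleton]
    refine Finset.sum_congr rfl fun p _ => ?_
    have e2 : η (p, 0) = ∑ q, φ (x p q) * ξ (q, 0) := by
      rw [hη, Matrix.mulVec, dotProduct, Fintype.sum_prod_type]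
      simp [hA, amp]
    change _ = star (η (p, 0)) * η (p, 0)
    conv_rhs => rw [e2, Finset.mul_sum, ← e2]
    refine Finset.sum_congr rfl fun q _ => ?_
    ring
  have hSle : S ≤ ‖φ‖ * (√S * matNorm m x * √T) := by
    have : ‖φ w‖ = S := by rw [hval, Complex.norm_real, Real.norm_of_nonneg hS0]
    refine this.symm.le.trans ?_
    exact (φ.norm_apply_le w).trans (mul_le_mul_of_nonneg_left hwn (norm_nonneg _))
  have h2 : √S ≤ ‖φ‖ * matNorm m x * √T := by
    rcases hS0.eq_or_lt with h | h
    · rw [← h, Real.sqrt_zero]; positivity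
    · have hp : 0 < √S := Real.sqrt_pos.mpr h
      refine le_of_mul_le_mul_left ?_ hp
      calc √S * √S = S := Real.mul_self_sqrt hS0
        _ ≤ _ := hSle
        _ = _ := by ring
  calc S = √S ^ 2 := (Real.sq_sqrt hS0).symm
    _ ≤ (‖φ‖ * matNorm m x * √T) ^ 2 := pow_le_pow_left₀ (Real.sqrt_nonneg _) h2 2
    _ = _ := by rw [mul_pow _ (√T), Real.sq_sqrt hT0]

theorem exists_cbBound {n : ℕ} (F : Matrix (Fin n) (Fin n) (OpDual V)) :
    ∃ c : ℝ, 0 ≤ c ∧ CBBound F c := by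
  have key : ∀ s : Finset (Fin n × Fin n), ∃ c : ℝ, 0 ≤ c ∧
      CBBound (∑ p ∈ s, Matrix.single p.1 p.2 (F p.1 p.2)) c := by
    intro s
    induction s using Finset.induction_on with
    | empty =>
      refine ⟨0, le_rfl, fun m x => ?_⟩
      have : amp (∑ p ∈ (∅ : Finset (Fin n × Fin n)), Matrix.single p.1 p.2 (F p.1 p.2)) x = 0 := by
        ext p q; simp [amp, OpDual.zero_apply]
      rw [this]; simp
    | insert p s hp ih =>
      obtain ⟨c, hc, h⟩ := ih
      rw [Finset.sum_insert hp]
      let α : Matrix (Fin n) (Fin 1) ℂ := Matrix.of fun i _ => if i = p.1 then 1 else 0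
      let β : Matrix (Fin 1) (Fin n) ℂ := Matrix.of fun _ j => if j = p.2 then 1 else 0
      have h1 := (cbBound_functional (F p.1 p.2)).scalarMul α β
      have e : scalarMul α (Matrix.of fun _ _ => F p.1 p.2) β
          = Matrix.single p.1 p.2 (F p.1 p.2) := by
        ext i j
        simp only [scalarMul, Matrix.of_apply, α, β, Matrix.single_apply, Finset.univ_unique,
          Finset.sum_singleton]
        by_cases hi : i = p.1 <;> by_cases hj : j = p.2 <;>
          simp [hi, hj, eq_comm]
      rw [e] at h1
      exact ⟨_, by positivity, h1.add h⟩
  obtain ⟨c, hc, h⟩ := key Finset.univ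
  refine ⟨c, hc, ?_⟩
  convert h
  rw [Fintype.sum_prod_type]
  exact Matrix.matrix_eq_sum_single F

theorem cbNorm_le {n : ℕ} {F : Matrix (Fin n) (Fin n) (OpDual V)} {c : ℝ} (hc : 0 ≤ c)
    (h : CBBound F c) : cbNorm n F ≤ c := by
  refine Real.sSup_le ?_ hc
  rintro r ⟨m, x, hx, rfl⟩
  exact (h m x).trans (mul_le_of_le_one_right hc hx)

theorem norm_amp_le_of_le_one {m n : ℕ} (F : Matrix (Fin n) (Fin n) (OpDual V))
    {x : Matrix (Fin m) (Fin m) V} (hx : matNorm m x ≤ 1) : ‖amp F x‖ ≤ cbNorm n F := by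
  obtain ⟨c, hc, h⟩ := exists_cbBound F
  refine le_csSup ⟨c, ?_⟩ ⟨m, x, hx, rfl⟩
  rintro r ⟨m, x, hx, rfl⟩
  exact (h m x).trans (mul_le_of_le_one_right hc hx)

theorem cbNorm_nonneg {n : ℕ} (F : Matrix (Fin n) (Fin n) (OpDual V)) : 0 ≤ cbNorm n F := by
  refine Real.sSup_nonneg ?_
  rintro r ⟨m, x, hx, rfl⟩
  exact norm_nonneg _

theorem cbBound_cbNorm {n : ℕ} (F : Matrix (Fin n) (Fin n) (OpDual V)) :
    CBBound F (cbNorm n F) := fun m x => by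
  rcases (matNorm_nonneg m x).eq_or_lt with h | h
  · rw [eq_zero_of_matNorm m x h.symm, matNorm_zero, mul_zero]
    have := amp_smul_right 0 F (0 : Matrix (Fin m) (Fin m) V)
    rw [zero_smul, zero_smul] at this
    rw [this, norm_zero]
  · set t := matNorm m x with ht
    have h1 : matNorm m (((t⁻¹ : ℝ) : ℂ) • x) ≤ 1 := by
      rw [matNorm_smul, Complex.norm_real, Real.norm_of_nonneg (by positivity), ← ht,
        inv_mul_cancel₀ h.ne']
    have h2 := norm_amp_le_of_le_one F h1
    rw [amp_smul_right, norm_smul, Complex.norm_real, Real.norm_of_nonneg (by positivity)] at h2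
    rwa [inv_mul_le_iff₀ h, mul_comm] at h2

theorem cbBound_block {m n : ℕ} {F : Matrix (Fin m) (Fin m) (OpDual V)}
    {G : Matrix (Fin n) (Fin n) (OpDual V)} {c : ℝ} (hc : 0 ≤ c) (hF : CBBound F c)
    (hG : CBBound G c) : CBBound (block F 0 0 G) c := fun k x => by
  have hcx : 0 ≤ c * matNorm k x := mul_nonneg hc (matNorm_nonneg k x)
  refine l2_norm_le hcx fun ξ => ?_
  have h1 := (sum_norm_mulVec_sq_le (amp F x) fun p => ξ (p.1, Fin.castAdd n p.2)).trans
    (mul_le_mul_of_nonneg_right (pow_le_pow_left₀ (norm_nonneg _) (hF k x) 2) (by positivity))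
  have h2 := (sum_norm_mulVec_sq_le (amp G x) fun p => ξ (p.1, Fin.natAdd m p.2)).trans
    (mul_le_mul_of_nonneg_right (pow_le_pow_left₀ (norm_nonneg _) (hG k x) 2) (by positivity))
  have h3 := add_le_add h1 h2
  rw [← mul_add] at h3
  simp only [Fintype.sum_prod_type, ← Finset.sum_add_distrib] at h3 ⊢
  refine le_trans (le_of_eq ?_) (h3.trans (le_of_eq ?_))
  · refine Finset.sum_congr rfl fun i _ => ?_
    rw [Fin.sum_univ_add]
    congr 1 <;> refine Finset.sum_congr rfl fun a _ => ?_ <;> congr 2 <;>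
      simp [Matrix.mulVec, dotProduct, Fintype.sum_prod_type, Fin.sum_univ_add, amp, block,
        OpDual.zero_apply]
  · congr 1
    refine Finset.sum_congr rfl fun i _ => ?_
    rw [Fin.sum_univ_add]

theorem norm_le_one_of_isometry {m n : ℕ} (α : Matrix (Fin m) (Fin n) ℂ)
    (h : α.conjTranspose * α = 1) : ‖α‖ ≤ 1 := by
  refine l2_norm_le zero_le_one fun ξ => ?_
  have e : ∀ {k : ℕ} (ζ : Fin k → ℂ), ((∑ i, ‖ζ i‖ ^ 2 : ℝ) : ℂ) = dotProduct (star ζ) ζ := by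
    intro k ζ
    push_cast
    exact Finset.sum_congr rfl fun i _ => (Complex.conj_mul' (ζ i)).symm
  have h2 : ((∑ i, ‖α.mulVec ξ i‖ ^ 2 : ℝ) : ℂ) = ((∑ i, ‖ξ i‖ ^ 2 : ℝ) : ℂ) := by
    rw [e, e, Matrix.star_mulVec, Matrix.dotProduct_mulVec, Matrix.vecMul_vecMul, h,
      Matrix.vecMul_one]
  rw [one_pow, one_mul]
  exact (Complex.ofReal_injective h2).le

theorem cbNorm_corner_le {k n : ℕ} (α : Matrix (Fin k) (Fin n) ℂ)
    (h : α.conjTranspose * α = 1) (F : Matrix (Fin k) (Fin k) (OpDual V)) :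
    cbNorm n (scalarMul α.conjTranspose F α) ≤ cbNorm k F := by
  have h1 := norm_le_one_of_isometry α h
  have h2 : ‖α.conjTranspose‖ ≤ 1 := by rwa [Matrix.l2_opNorm_conjTranspose]
  have h0 := cbNorm_nonneg F
  refine (cbNorm_le (by positivity) ((cbBound_cbNorm F).scalarMul α.conjTranspose α)).trans ?_
  calc ‖α.conjTranspose‖ * cbNorm k F * ‖α‖ ≤ 1 * cbNorm k F * 1 := by gcongr
    _ = cbNorm k F := by ring

/-- The operator space dual, with `M_n(V^*) = CB(V, M_n)`. -/
instance : OperatorSpace (OpDual V) where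
  matNorm := cbNorm
  matNorm_add_le n F G := cbNorm_le (add_nonneg (cbNorm_nonneg F) (cbNorm_nonneg G))
    ((cbBound_cbNorm F).add (cbBound_cbNorm G))
  matNorm_smul n c F := by
    have key : ∀ (c : ℂ) (F : Matrix (Fin n) (Fin n) (OpDual V)),
        cbNorm n (c • F) ≤ ‖c‖ * cbNorm n F := fun c F =>
      cbNorm_le (mul_nonneg (norm_nonneg _) (cbNorm_nonneg F)) fun m x => by
        rw [amp_smul, norm_smul, mul_assoc]
        exact mul_le_mul_of_nonneg_left (cbBound_cbNorm F m x) (norm_nonneg _)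
    refine le_antisymm (key c F) ?_
    rcases eq_or_ne c 0 with rfl | hc
    · rw [norm_zero, zero_mul]; exact cbNorm_nonneg _
    · have h := key c⁻¹ (c • F)
      rw [smul_smul, inv_mul_cancel₀ hc, one_smul, norm_inv] at h
      rwa [← le_inv_mul_iff₀ (norm_pos_iff.mpr hc)]
  eq_zero_of_matNorm n F h := by
    ext i j : 1
    refine OpDual.ext fun v => ?_
    have h1 := cbBound_cbNorm F 1 (Matrix.of fun _ _ => v)
    rw [h, zero_mul] at h1
    have h2 : amp F (Matrix.of fun _ _ => v : Matrix (Fin 1) (Fin 1) V) = 0 :=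
      norm_le_zero_iff.mp h1
    exact congrFun (congrFun h2 (0, i)) (0, j)
  matNorm_one φ := by
    refine le_antisymm (cbNorm_le (norm_nonneg _) (cbBound_functional φ)) ?_
    refine OpDual.norm_le (cbNorm_nonneg _) fun v => ?_
    have h1 := cbBound_cbNorm (Matrix.of fun _ _ => φ : Matrix (Fin 1) (Fin 1) (OpDual V)) 1
      (Matrix.of fun _ _ => v)
    rw [matNorm_one] at h1
    refine le_trans ?_ h1
    have h2 := sum_norm_mulVec_sq_le
      (amp (Matrix.of fun _ _ => φ : Matrix (Fin 1) (Fin 1) (OpDual V))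
        (Matrix.of fun _ _ => v : Matrix (Fin 1) (Fin 1) V)) (fun _ => 1)
    simp [amp, Matrix.mulVec, dotProduct] at h2
    exact (sq_le_sq₀ (norm_nonneg _) (norm_nonneg _)).mp h2
  matNorm_directSum m n F G := by
    refine le_antisymm ?_ (max_le ?_ ?_)
    · have hm : 0 ≤ max (cbNorm m F) (cbNorm n G) := le_max_of_le_left (cbNorm_nonneg F)
      refine cbNorm_le hm (cbBound_block hm (fun k x => ?_) (fun k x => ?_))
      · exact (cbBound_cbNorm F k x).trans
          (mul_le_mul_of_nonneg_right (le_max_left _ _) (matNorm_nonneg k x))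
      · exact (cbBound_cbNorm G k x).trans
          (mul_le_mul_of_nonneg_right (le_max_right _ _) (matNorm_nonneg k x))
    · let α : Matrix (Fin (m + n)) (Fin m) ℂ := Matrix.of fun i j =>
        if i = Fin.castAdd n j then 1 else 0
      have hα : α.conjTranspose * α = 1 := by
        ext i j
        simp [Matrix.mul_apply, α, Matrix.one_apply, apply_ite, eq_comm]
      convert! cbNorm_corner_le α hα (block F 0 0 G)
      ext i j : 1
      simp [scalarMul, α, block, apply_ite]
    · let α : Matrix (Fin (m + n)) (Fin n) ℂ := Matrix.of fun i j =>
        if i = Fin.natAdd m j then 1 else 0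
      have hα : α.conjTranspose * α = 1 := by
        ext i j
        simp [Matrix.mul_apply, α, Matrix.one_apply, apply_ite, eq_comm]
      convert! cbNorm_corner_le α hα (block F 0 0 G)
      ext i j : 1
      simp [scalarMul, α, block, apply_ite]
  matNorm_scalarMul_le m n α F β :=
    cbNorm_le (mul_nonneg (mul_nonneg (norm_nonneg _) (cbNorm_nonneg F)) (norm_nonneg _))
      ((cbBound_cbNorm F).scalarMul α β)

end DualNorm

section DualOrder

variable {V : Type*} [NormedAddCommGroup V] [NormedSpace ℂ V] [StarAddMonoid V]
  [StarModule ℂ V] [MatrixOrderedOperatorSpace V]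

theorem amp_conjTranspose {m n : ℕ} (F : Matrix (Fin n) (Fin n) (OpDual V))
    (x : Matrix (Fin m) (Fin m) V) :
    amp F.conjTranspose x = (amp F x.conjTranspose).conjTranspose := rfl

/-- The positive cone of `M_n(V^*)`: the completely positive maps `V → M_n`, that is, the
selfadjoint ones whose amplifications send `M_m(V)^+` into the positive semidefinite matrices. -/
def dualCone (V : Type*) [NormedAddCommGroup V] [NormedSpace ℂ V] [StarAddMonoid V]
    [StarModule ℂ V] [MatrixOrderedOperatorSpace V] (n : ℕ) :
    Set (Matrix (Fin n) (Fin n) (OpDual V)) :=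
  {F | F.IsHermitian ∧
    ∀ (m : ℕ) (x : Matrix (Fin m) (Fin m) V), x ∈ cone m → (amp F x).PosSemidef}

theorem cbNorm_conjTranspose_le {n : ℕ} (F : Matrix (Fin n) (Fin n) (OpDual V)) :
    cbNorm n F.conjTranspose ≤ cbNorm n F := by
  refine cbNorm_le (cbNorm_nonneg F) fun m x => ?_
  rw [amp_conjTranspose, Matrix.l2_opNorm_conjTranspose, ← matNorm_conjTranspose m x]
  exact cbBound_cbNorm F m _

theorem posSemidef_of_approx {ι : Type*} [Fintype ι] [DecidableEq ι] (A : Matrix ι ι ℂ)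
    (h : ∀ ε : ℝ, 0 < ε → ∃ B : Matrix ι ι ℂ, B.PosSemidef ∧ ‖A - B‖ < ε) : A.PosSemidef := by
  have hcl : IsClosed {B : Matrix ι ι ℂ | B.PosSemidef} := by
    have e : {B : Matrix ι ι ℂ | B.PosSemidef} = {B | B.conjTranspose = B} ∩
        ⋂ ξ : ι → ℂ, {B | 0 ≤ dotProduct (star ξ) (B.mulVec ξ)} := by
      ext B
      simp only [Set.mem_ofPred_eq, Set.mem_inter_iff, Set.mem_iInter,
        Matrix.posSemidef_iff_dotProduct_mulVec]
      rfl
    rw [e]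
    refine IsClosed.inter (isClosed_eq (by fun_prop) continuous_id) (isClosed_iInter fun ξ => ?_)
    exact isClosed_le continuous_const (by fun_prop)
  have : A ∈ closure {B : Matrix ι ι ℂ | B.PosSemidef} := by
    rw [Metric.mem_closure_iff]
    intro ε hε
    obtain ⟨B, hB, hAB⟩ := h ε hε
    exact ⟨B, hB, by rwa [dist_eq_norm]⟩
  rwa [hcl.closure_eq] at this

/-- The matrix ordered operator space dual `V^*` of a matrix ordered operator space `V`. -/
instance : MatrixOrderedOperatorSpace (OpDual V) where
  cone := dualCone V
  zero_mem_cone n := ⟨by simp [Matrix.IsHermitian], fun m x _ => by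
    have : amp (0 : Matrix (Fin n) (Fin n) (OpDual V)) x = 0 := rfl
    rw [this]; exact Matrix.PosSemidef.zero⟩
  add_mem_cone n F G hF hG := ⟨hF.1.add hG.1, fun m x hx => (hF.2 m x hx).add (hG.2 m x hx)⟩
  smul_mem_cone n r F hr hF := by
    refine ⟨?_, fun m x hx => ?_⟩
    · have h := hF.1
      rw [Matrix.IsHermitian] at h ⊢
      rw [Matrix.conjTranspose_smul, h]
      congr 1
      exact Complex.conj_ofReal r
    · rw [amp_smul]
      exact (hF.2 m x hx).smul (by exact_mod_cast hr)
  isHermitian_of_mem_cone n F hF := hF.1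
  scalarMul_mem_cone m n α F hF := by
    refine ⟨?_, fun k x hx => ?_⟩
    · ext i j : 1
      simp only [scalarMul, Matrix.conjTranspose_apply, Matrix.of_apply, star_sum, star_smul,
        star_mul', star_star]
      rw [Finset.sum_comm]
      refine Finset.sum_congr rfl fun p _ => Finset.sum_congr rfl fun q _ => ?_
      rw [hF.1.apply, mul_comm]
    · rw [amp_scalarMul]
      have h := (hF.2 k x hx).conjTranspose_mul_mul_same
        ((1 : Matrix (Fin k) (Fin k) ℂ).kronecker α)
      have e : (1 : Matrix (Fin k) (Fin k) ℂ).kronecker α.conjTranspose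
          = ((1 : Matrix (Fin k) (Fin k) ℂ).kronecker α).conjTranspose := by
        refine ((Matrix.conjTranspose_kronecker (1 : Matrix (Fin k) (Fin k) ℂ) α).trans ?_).symm
        rw [Matrix.conjTranspose_one]
        rfl
      rw [← e] at h
      exact h
  matNorm_conjTranspose n F := by
    refine le_antisymm (cbNorm_conjTranspose_le F) ?_
    have h := cbNorm_conjTranspose_le F.conjTranspose
    rwa [Matrix.conjTranspose_conjTranspose] at h
  cone_closed n F h := by
    have key : ∀ (m : ℕ) (x : Matrix (Fin m) (Fin m) V) (ε : ℝ), 0 < ε →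
        ∃ G ∈ dualCone V n, ‖amp F x - amp G x‖ < ε := by
      intro m x ε hε
      have hpos : 0 < matNorm m x + 1 := by linarith [matNorm_nonneg m x]
      obtain ⟨G, hG, hFG⟩ := h (ε / (matNorm m x + 1)) (by positivity)
      refine ⟨G, hG, ?_⟩
      rw [← amp_sub]
      refine lt_of_le_of_lt (cbBound_cbNorm (F - G) m x) ?_
      have hFG' : cbNorm n (F - G) < ε / (matNorm m x + 1) := hFG
      rw [lt_div_iff₀ hpos] at hFG'
      nlinarith [cbNorm_nonneg (F - G)]
    refine ⟨?_, fun m x hx => posSemidef_of_approx _ fun ε hε => ?_⟩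
    · have hz : matNorm n (F.conjTranspose - F) = 0 := by
        refine le_antisymm (le_of_forall_pos_le_add fun ε hε => ?_) (matNorm_nonneg n _)
        obtain ⟨G, hG, hFG⟩ := h (ε / 2) (by positivity)
        have e : F.conjTranspose - F = (F - G).conjTranspose + (-1 : ℂ) • (F - G) := by
          rw [Matrix.conjTranspose_sub, hG.1.eq, neg_smul, one_smul]; abel
        have h1 := matNorm_add_le n (F - G).conjTranspose ((-1 : ℂ) • (F - G))
        rw [matNorm_smul] at h1
        have h2 : matNorm n (F - G).conjTranspose ≤ matNorm n (F - G) :=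
          cbNorm_conjTranspose_le _
        have hFG' : matNorm n (F - G) < ε / 2 := hFG
        rw [e]
        simp only [norm_neg, norm_one, one_mul] at h1
        linarith
      exact sub_eq_zero.mp (eq_zero_of_matNorm n _ hz)
    · obtain ⟨G, hG, hFG⟩ := key m x ε hε
      exact ⟨amp G x, hG.2 m x hx, hFG⟩

end DualOrder

section Notions

variable (V : Type*) [NormedAddCommGroup V] [NormedSpace ℂ V] [StarAddMonoid V]
  [StarModule ℂ V] [MatrixOrderedOperatorSpace V]

/-- Matrix regular operator spaces. Here `u - v ∈ M_n(V)^+` and `v + u ∈ M_n(V)^+` express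
`-u ≤ v ≤ u`. -/
structure IsMatrixRegular : Prop where
  complete : CompleteSpace V
  norm_le : ∀ (n : ℕ) (v u : Matrix (Fin n) (Fin n) V), v.IsHermitian → u ∈ cone n →
    v + u ∈ cone n → u - v ∈ cone n → matNorm n v ≤ matNorm n u
  exists_bound : ∀ (n : ℕ) (v : Matrix (Fin n) (Fin n) V), v.IsHermitian → matNorm n v < 1 →
    ∃ u ∈ cone n, matNorm n u < 1 ∧ v + u ∈ cone n ∧ u - v ∈ cone n

variable {V} in
/-- `φ` is a positive functional of norm at most one on `M_n(V)`. -/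
structure IsPosContractive {n : ℕ} (φ : Matrix (Fin n) (Fin n) V →ₗ[ℂ] ℂ) : Prop where
  selfAdjoint : ∀ x, φ x.conjTranspose = star (φ x)
  nonneg : ∀ x ∈ cone n, 0 ≤ φ x
  norm_le : ∀ x, ‖φ x‖ ≤ matNorm n x

variable {V} in
/-- The modified numerical radius `ν_V(x)` of `x ∈ M_n(V)`. -/
def numRadius {n : ℕ} (x : Matrix (Fin n) (Fin n) V) : ℝ :=
  sSup {r : ℝ | ∃ φ : Matrix (Fin (n + n)) (Fin (n + n)) V →ₗ[ℂ] ℂ,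
    IsPosContractive φ ∧ r = ‖φ (block 0 x x.conjTranspose 0)‖}

/-- (Nonunital) operator systems in the sense of Werner. -/
structure IsOperatorSystem : Prop where
  proper : ∀ (n : ℕ) (x : Matrix (Fin n) (Fin n) V), x ∈ cone n → -x ∈ cone n → x = 0
  norm_le : ∃ k : ℝ, 0 < k ∧ ∀ (n : ℕ) (x : Matrix (Fin n) (Fin n) V),
    matNorm n x ≤ k * numRadius x

end Notions

section Maps

variable {V W : Type*} [NormedAddCommGroup V] [NormedSpace ℂ V] [StarAddMonoid V]
  [StarModule ℂ V] [MatrixOrderedOperatorSpace V] [NormedAddCommGroup W] [NormedSpace ℂ W]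
  [StarAddMonoid W] [StarModule ℂ W] [MatrixOrderedOperatorSpace W]

/-- `Φ` is completely bounded: its amplifications `Φ_n` are bounded uniformly in `n`. -/
def IsCompletelyBounded (Φ : V →ₗ[ℂ] W) : Prop :=
  ∃ c : ℝ, ∀ (n : ℕ) (x : Matrix (Fin n) (Fin n) V), matNorm n (x.map Φ) ≤ c * matNorm n x

/-- `Φ` is completely positive: it is selfadjoint and maps `M_n(V)^+` into `M_n(W)^+`. -/
structure IsCompletelyPositive (Φ : V →ₗ[ℂ] W) : Prop where
  map_star : ∀ v, Φ (star v) = star (Φ v)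
  map_cone : ∀ (n : ℕ) (x : Matrix (Fin n) (Fin n) V), x ∈ cone n → x.map Φ ∈ cone n

/-- `Φ` is both a complete isomorphism and a complete order isomorphism from `V` onto `W`. -/
structure IsCompleteOrderIso (Φ : V ≃ₗ[ℂ] W) : Prop where
  cb : IsCompletelyBounded (Φ : V →ₗ[ℂ] W)
  cb_symm : IsCompletelyBounded (Φ.symm : W →ₗ[ℂ] V)
  cp : IsCompletelyPositive (Φ : V →ₗ[ℂ] W)
  cp_symm : IsCompletelyPositive (Φ.symm : W →ₗ[ℂ] V)

end Maps

end MatOrd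

end

/-! Everything is reduced to two properties of the order relative to the norm. Normality
(`IsNormal`) bounds ‖x‖ by k‖z‖ whenever z dominates (0 x; x^* 0). Generation (`IsGenerating`) makes
every x the corner of a positive (a x; x^* b) with ‖a‖, ‖b‖ ≤ K‖x‖. By Hahn–Banach, the numerical
radius of x is the distance from (0 x; x^* 0) to the negative of the cone. Hence being an operator
system is the same as normality for some k, and properness of the cones comes for free
(`isOperatorSystem_iff`).

A matrix regular space is monotone and generating, and both properties survive a complete order
isomorphism up to constants. Together they make V normal (`IsGenerating.isNormal`). Generation alone
makes V^* normal (`IsGenerating.isNormal_dual`): a completely positive map is evaluated at a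
positive (a x; x^* b), and in a positive scalar block matrix the corner is bounded by the diagonal.

The converse rests on the fact that normality of V^* forces generation in V
(`IsNormal.isGenerating`). If x were not within half its norm of such a corner, Hahn–Banach would
give a positive functional (A B; C D) on M_2n(V) with contractive diagonal and B large at x. Here A
and D are bounded as functionals on M_n(V), while normality of V^* speaks of cb-norms. The two are
linked by factoring a contractive functional as τ^* G τ, with bounds on the cb-norm of G and on the
Hilbert–Schmidt norm of τ (`exists_scaling`, from the density matrix of `exists_density`). This
bounds B, a contradiction. Completeness and closed cones then turn approximate corners into exact
ones through a geometric series.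

Once V is normal and generating, the gauge `regNorm` of the dominated matrices is equivalent to the
given norms uniformly in n, and it is matrix regular for the same cones. -/

noncomputable section

namespace MatOrd

open OperatorSpace MatrixOrdered MatrixOrderedOperatorSpace

/-! ### Scalar multiplication and block matrices. -/

section Algebra

variable {V : Type*} [AddCommGroup V] [Module ℂ V]

theorem scalarMul_zero {k l m n : ℕ} (α : Matrix (Fin k) (Fin l) ℂ)
    (β : Matrix (Fin m) (Fin n) ℂ) :
    scalarMul α (0 : Matrix (Fin l) (Fin m) V) β = 0 := by
  ext i j
  simp [scalarMul]

theorem smul_scalarMul {k l m n : ℕ} (c : ℂ) (α : Matrix (Fin k) (Fin l) ℂ)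
    (x : Matrix (Fin l) (Fin m) V) (β : Matrix (Fin m) (Fin n) ℂ) :
    scalarMul (c • α) x β = c • scalarMul α x β := by
  ext i j
  simp [scalarMul, Finset.smul_sum, smul_smul, mul_assoc]

theorem scalarMul_smul_right {k l m n : ℕ} (c : ℂ) (α : Matrix (Fin k) (Fin l) ℂ)
    (x : Matrix (Fin l) (Fin m) V) (β : Matrix (Fin m) (Fin n) ℂ) :
    scalarMul α x (c • β) = c • scalarMul α x β := by
  ext i j
  simp only [scalarMul, Finset.smul_sum, smul_smul, Matrix.of_apply, Matrix.smul_apply, smul_eq_mul]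
  refine Finset.sum_congr rfl fun p _ => Finset.sum_congr rfl fun q _ => ?_
  congr 1
  ring

theorem add_scalarMul {k l m n : ℕ} (α α' : Matrix (Fin k) (Fin l) ℂ)
    (x : Matrix (Fin l) (Fin m) V) (β : Matrix (Fin m) (Fin n) ℂ) :
    scalarMul (α + α') x β = scalarMul α x β + scalarMul α' x β := by
  ext i j
  simp [scalarMul, add_mul, add_smul, Finset.sum_add_distrib]

theorem scalarMul_add_right {k l m n : ℕ} (α : Matrix (Fin k) (Fin l) ℂ)
    (x : Matrix (Fin l) (Fin m) V) (β β' : Matrix (Fin m) (Fin n) ℂ) :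
    scalarMul α x (β + β') = scalarMul α x β + scalarMul α x β' := by
  ext i j
  simp [scalarMul, mul_add, add_smul, Finset.sum_add_distrib]

theorem zero_scalarMul {k l m n : ℕ} (x : Matrix (Fin l) (Fin m) V)
    (β : Matrix (Fin m) (Fin n) ℂ) :
    scalarMul (0 : Matrix (Fin k) (Fin l) ℂ) x β = 0 := by
  ext i j
  simp [scalarMul]

theorem scalarMul_zero_right {k l m n : ℕ} (α : Matrix (Fin k) (Fin l) ℂ)
    (x : Matrix (Fin l) (Fin m) V) :
    scalarMul α x (0 : Matrix (Fin m) (Fin n) ℂ) = 0 := by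
  ext i j
  simp [scalarMul]

theorem one_scalarMul_one {m n : ℕ} (x : Matrix (Fin m) (Fin n) V) : scalarMul 1 x 1 = x := by
  ext i j
  simp [scalarMul, Matrix.one_apply]

theorem scalarMul_scalarMul {k l m n k' n' : ℕ} (α' : Matrix (Fin k') (Fin k) ℂ)
    (α : Matrix (Fin k) (Fin l) ℂ) (x : Matrix (Fin l) (Fin m) V) (β : Matrix (Fin m) (Fin n) ℂ)
    (β' : Matrix (Fin n) (Fin n') ℂ) :
    scalarMul α' (scalarMul α x β) β' = scalarMul (α' * α) x (β * β') := by
  ext i j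
  simp only [scalarMul, Matrix.of_apply, Matrix.mul_apply, Finset.smul_sum, smul_smul,
    Finset.sum_mul_sum, Finset.sum_smul]
  calc _ = ∑ a, ∑ p, ∑ b, ∑ q, (α' i a * β' b j * (α a p * β q b)) • x p q :=
        Finset.sum_congr rfl fun a _ => Finset.sum_comm
    _ = ∑ p, ∑ a, ∑ q, ∑ b, (α' i a * β' b j * (α a p * β q b)) • x p q := by
        rw [Finset.sum_comm]
        exact Finset.sum_congr rfl fun a _ => Finset.sum_congr rfl fun a _ => Finset.sum_comm
    _ = ∑ p, ∑ q, ∑ a, ∑ b, (α' i a * β' b j * (α a p * β q b)) • x p q :=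
        Finset.sum_congr rfl fun a _ => Finset.sum_comm
    _ = _ := by
        refine Finset.sum_congr rfl fun p _ => Finset.sum_congr rfl fun q _ =>
          Finset.sum_congr rfl fun a _ => Finset.sum_congr rfl fun b _ => ?_
        congr 1
        ring

theorem conjTranspose_scalarMul [StarAddMonoid V] [StarModule ℂ V] {k l m n : ℕ}
    (α : Matrix (Fin k) (Fin l) ℂ) (x : Matrix (Fin l) (Fin m) V) (β : Matrix (Fin m) (Fin n) ℂ) :
    (scalarMul α x β).conjTranspose
      = scalarMul β.conjTranspose x.conjTranspose α.conjTranspose := by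
  ext i j
  simp only [scalarMul, Matrix.conjTranspose_apply, Matrix.of_apply, star_sum, star_smul]
  rw [Finset.sum_comm]
  refine Finset.sum_congr rfl fun p _ => Finset.sum_congr rfl fun q _ => ?_
  simp [mul_comm]

end Algebra

section Blocks

variable {V : Type*} {m n : ℕ} (a : Matrix (Fin m) (Fin m) V) (b : Matrix (Fin m) (Fin n) V)
  (c : Matrix (Fin n) (Fin m) V) (d : Matrix (Fin n) (Fin n) V)

@[simp] theorem block_left_left (i j : Fin m) :
    block a b c d (Fin.castAdd n i) (Fin.castAdd n j) = a i j := by simp [block]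

@[simp] theorem block_left_right (i : Fin m) (j : Fin n) :
    block a b c d (Fin.castAdd n i) (Fin.natAdd m j) = b i j := by simp [block]

@[simp] theorem block_right_left (i : Fin n) (j : Fin m) :
    block a b c d (Fin.natAdd m i) (Fin.castAdd n j) = c i j := by simp [block]

@[simp] theorem block_right_right (i j : Fin n) :
    block a b c d (Fin.natAdd m i) (Fin.natAdd m j) = d i j := by simp [block]

theorem matrix_ext_block {x y : Matrix (Fin (m + n)) (Fin (m + n)) V}
    (h₁ : ∀ i j, x (Fin.castAdd n i) (Fin.castAdd n j) = y (Fin.castAdd n i) (Fin.castAdd n j))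
    (h₂ : ∀ i j, x (Fin.castAdd n i) (Fin.natAdd m j) = y (Fin.castAdd n i) (Fin.natAdd m j))
    (h₃ : ∀ i j, x (Fin.natAdd m i) (Fin.castAdd n j) = y (Fin.natAdd m i) (Fin.castAdd n j))
    (h₄ : ∀ i j, x (Fin.natAdd m i) (Fin.natAdd m j) = y (Fin.natAdd m i) (Fin.natAdd m j)) :
    x = y := by
  ext i j
  exact Fin.addCases (fun i => Fin.addCases (fun j => h₁ i j) (fun j => h₂ i j) j)
    (fun i => Fin.addCases (fun j => h₃ i j) (fun j => h₄ i j) j) i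

theorem eq_block (x : Matrix (Fin (m + n)) (Fin (m + n)) V) :
    x = block (x.submatrix (Fin.castAdd n) (Fin.castAdd n))
      (x.submatrix (Fin.castAdd n) (Fin.natAdd m)) (x.submatrix (Fin.natAdd m) (Fin.castAdd n))
      (x.submatrix (Fin.natAdd m) (Fin.natAdd m)) := by
  apply matrix_ext_block <;> simp [-Fin.natAdd_eq_addNat]

end Blocks

section Blocks

variable {V : Type*} [AddCommGroup V] {m n : ℕ} (a : Matrix (Fin m) (Fin m) V)
  (b : Matrix (Fin m) (Fin n) V) (c : Matrix (Fin n) (Fin m) V) (d : Matrix (Fin n) (Fin n) V)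

theorem block_add (a' : Matrix (Fin m) (Fin m) V) (b' : Matrix (Fin m) (Fin n) V)
    (c' : Matrix (Fin n) (Fin m) V) (d' : Matrix (Fin n) (Fin n) V) :
    block a b c d + block a' b' c' d' = block (a + a') (b + b') (c + c') (d + d') := by
  apply matrix_ext_block <;> simp [-Fin.natAdd_eq_addNat]

theorem block_sub (a' : Matrix (Fin m) (Fin m) V) (b' : Matrix (Fin m) (Fin n) V)
    (c' : Matrix (Fin n) (Fin m) V) (d' : Matrix (Fin n) (Fin n) V) :
    block a b c d - block a' b' c' d' = block (a - a') (b - b') (c - c') (d - d') := by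
  apply matrix_ext_block <;> simp [-Fin.natAdd_eq_addNat]

theorem block_neg : -block a b c d = block (-a) (-b) (-c) (-d) := by
  apply matrix_ext_block <;> simp [-Fin.natAdd_eq_addNat]

theorem block_zero : block (0 : Matrix (Fin m) (Fin m) V) 0 0 (0 : Matrix (Fin n) (Fin n) V) = 0 := by
  apply matrix_ext_block <;> simp [-Fin.natAdd_eq_addNat]

theorem block_conjTranspose [StarAddMonoid V] : (block a b c d).conjTranspose
    = block a.conjTranspose c.conjTranspose b.conjTranspose d.conjTranspose := by
  apply matrix_ext_block <;> simp [-Fin.natAdd_eq_addNat]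

variable [Module ℂ V]

/-- The rectangular direct sum of two scalar matrices. -/
def dsum {k l k' l' : ℕ} (α : Matrix (Fin k) (Fin l) ℂ) (β : Matrix (Fin k') (Fin l') ℂ) :
    Matrix (Fin (k + k')) (Fin (l + l')) ℂ :=
  Matrix.reindex finSumFinEquiv finSumFinEquiv (Matrix.fromBlocks α 0 0 β)

theorem dsum_conjTranspose {k l k' l' : ℕ} (α : Matrix (Fin k) (Fin l) ℂ)
    (β : Matrix (Fin k') (Fin l') ℂ) :
    (dsum α β).conjTranspose = dsum α.conjTranspose β.conjTranspose := by
  rw [dsum, dsum, Matrix.conjTranspose_reindex, Matrix.fromBlocks_conjTranspose]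
  simp

theorem scalarMul_dsum_block {k k' : ℕ} (α : Matrix (Fin k) (Fin m) ℂ)
    (β : Matrix (Fin k') (Fin n) ℂ) (γ : Matrix (Fin m) (Fin k) ℂ) (δ : Matrix (Fin n) (Fin k') ℂ) :
    scalarMul (dsum α β) (block a b c d) (dsum γ δ)
      = block (scalarMul α a γ) (scalarMul α b δ) (scalarMul β c γ) (scalarMul β d δ) := by
  apply matrix_ext_block <;> simp [scalarMul, dsum, Fin.sum_univ_add]

end Blocks

section Algebra

variable {V : Type*} [AddCommGroup V] [Module ℂ V]

/-- The `0`-`1` matrix that selects the columns given by `f`. -/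
def sel {m n : ℕ} (f : Fin n → Fin m) : Matrix (Fin m) (Fin n) ℂ :=
  Matrix.of fun p j => if p = f j then 1 else 0

theorem scalarMul_sel {k l m n : ℕ} (f : Fin k → Fin l) (g : Fin n → Fin m)
    (x : Matrix (Fin l) (Fin m) V) :
    scalarMul (sel f).conjTranspose x (sel g) = x.submatrix f g := by
  ext i j
  simp [scalarMul, sel, apply_ite]

@[simp] theorem sel_castAdd_left {m n : ℕ} (i j : Fin m) :
    sel (Fin.castAdd n) (Fin.castAdd n i) j = if i = j then 1 else 0 := by
  simp [sel]

@[simp] theorem sel_castAdd_right {m n : ℕ} (i : Fin n) (j : Fin m) :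
    sel (Fin.castAdd n) (Fin.natAdd m i) j = 0 := by
  rw [sel, Matrix.of_apply, if_neg]
  simp only [Fin.ext_iff, Fin.val_natAdd, Fin.val_castAdd]
  omega

@[simp] theorem sel_natAdd_left {m n : ℕ} (i : Fin m) (j : Fin n) :
    sel (Fin.natAdd m) (Fin.castAdd n i) j = 0 := by
  rw [sel, Matrix.of_apply, if_neg]
  simp only [Fin.ext_iff, Fin.val_natAdd, Fin.val_castAdd]
  omega

@[simp] theorem sel_natAdd_right {m n : ℕ} (i j : Fin n) :
    sel (Fin.natAdd m) (Fin.natAdd m i) j = if i = j then 1 else 0 := by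
  simp [sel]

/-- With this form, stability of the cones under x ↦ α x α^* and under addition settles direct sums.
-/
theorem block_diag_eq_add {m n : ℕ} (a : Matrix (Fin m) (Fin m) V) (b : Matrix (Fin n) (Fin n) V) :
    block a 0 0 b
      = scalarMul (sel (Fin.castAdd n)) a (sel (Fin.castAdd n)).conjTranspose
        + scalarMul (sel (Fin.natAdd m)) b (sel (Fin.natAdd m)).conjTranspose := by
  apply matrix_ext_block <;> simp [scalarMul, apply_ite]

theorem sel_isometry {m n : ℕ} {f : Fin n → Fin m} (hf : Function.Injective f) :
    (sel f).conjTranspose * sel f = 1 := by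
  ext i j
  simp [Matrix.mul_apply, sel, Matrix.one_apply, apply_ite, hf.eq_iff, eq_comm]

theorem norm_sel_le {m n : ℕ} {f : Fin n → Fin m} (hf : Function.Injective f) : ‖sel f‖ ≤ 1 :=
  norm_le_one_of_isometry _ (sel_isometry hf)

end Algebra

/-! ### Norm estimates for blocks and entries. -/

section Norms

variable {V : Type*} [NormedAddCommGroup V] [NormedSpace ℂ V] [OperatorSpace V]

theorem matNorm_sum_le {ι : Type*} {n : ℕ} (s : Finset ι) (x : ι → Matrix (Fin n) (Fin n) V) :
    matNorm n (∑ i ∈ s, x i) ≤ ∑ i ∈ s, matNorm n (x i) := by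
  classical
  induction s using Finset.induction_on with
  | empty => simp [matNorm_zero]
  | insert a s ha ih =>
    rw [Finset.sum_insert ha, Finset.sum_insert ha]
    exact (matNorm_add_le n _ _).trans (by gcongr)

theorem matNorm_scalarMul_le_of_le_one {m n : ℕ} {α : Matrix (Fin n) (Fin m) ℂ}
    {β : Matrix (Fin m) (Fin n) ℂ} (hα : ‖α‖ ≤ 1) (hβ : ‖β‖ ≤ 1) (x : Matrix (Fin m) (Fin m) V) :
    matNorm n (scalarMul α x β) ≤ matNorm m x := by
  refine (matNorm_scalarMul_le m n α x β).trans ?_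
  have h0 := matNorm_nonneg m x
  calc ‖α‖ * matNorm m x * ‖β‖ ≤ 1 * matNorm m x * 1 := by gcongr
    _ = matNorm m x := by ring

theorem matNorm_submatrix_le {m n : ℕ} {f g : Fin n → Fin m} (hf : Function.Injective f)
    (hg : Function.Injective g) (x : Matrix (Fin m) (Fin m) V) :
    matNorm n (x.submatrix f g) ≤ matNorm m x := by
  rw [← scalarMul_sel]
  refine matNorm_scalarMul_le_of_le_one ?_ (norm_sel_le hg) x
  rw [Matrix.l2_opNorm_conjTranspose]
  exact norm_sel_le hf

/-- The exchange of the two halves of `Fin (n + n)`. -/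
def swapHalves {n : ℕ} : Fin (n + n) → Fin (n + n) :=
  Fin.addCases (fun i => Fin.natAdd n i) (fun i => Fin.castAdd n i)

@[simp] theorem swapHalves_castAdd {n : ℕ} (i : Fin n) :
    swapHalves (Fin.castAdd n i) = Fin.natAdd n i := by simp [swapHalves]

@[simp] theorem swapHalves_natAdd {n : ℕ} (i : Fin n) :
    swapHalves (Fin.natAdd n i) = Fin.castAdd n i := by
  simp [swapHalves, -Fin.natAdd_eq_addNat]

theorem swapHalves_injective {n : ℕ} : Function.Injective (swapHalves (n := n)) := by
  have : Function.Involutive (swapHalves (n := n)) := fun i =>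
    Fin.addCases (fun i => by simp [-Fin.natAdd_eq_addNat])
      (fun i => by simp [-Fin.natAdd_eq_addNat]) i
  exact this.injective

/-- The off-diagonal part is a direct sum up to a permutation of columns, so its norm is a maximum
too. -/
theorem matNorm_block_le {n : ℕ} (a b c d : Matrix (Fin n) (Fin n) V) :
    matNorm (n + n) (block a b c d)
      ≤ max (matNorm n a) (matNorm n d) + max (matNorm n b) (matNorm n c) := by
  have e : block a b c d = block a 0 0 d + (block b 0 0 c).submatrix id swapHalves := by
    apply matrix_ext_block <;> simp [-Fin.natAdd_eq_addNat]
  rw [e]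
  refine (matNorm_add_le _ _ _).trans (add_le_add (matNorm_directSum _ _ _ _).le ?_)
  exact (matNorm_submatrix_le Function.injective_id swapHalves_injective _).trans
    (matNorm_directSum _ _ _ _).le

/-- Conjugation by diag(1, -1) flips the off-diagonal part. Together with `block_neg_mem_cone` it
makes one-sided domination of (0 x; x^* 0) two-sided. -/
theorem matNorm_block_neg_le {n : ℕ} (a b c d : Matrix (Fin n) (Fin n) V) :
    matNorm (n + n) (block a (-b) (-c) d) ≤ matNorm (n + n) (block a b c d) := by
  let δ : Matrix (Fin (n + n)) (Fin (n + n)) ℂ := dsum 1 (-1)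
  have hδ : ‖δ‖ ≤ 1 := by
    refine norm_le_one_of_isometry _ ?_
    rw [dsum_conjTranspose]
    simp [δ, dsum, Matrix.fromBlocks_multiply]
  have e : block a (-b) (-c) d = scalarMul δ (block a b c d) δ := by
    rw [scalarMul_dsum_block, one_scalarMul_one, ← neg_one_smul ℂ (1 : Matrix (Fin n) (Fin n) ℂ)]
    simp only [smul_scalarMul, scalarMul_smul_right, one_scalarMul_one, smul_smul]
    simp
  rw [e]
  exact matNorm_scalarMul_le_of_le_one hδ hδ _

theorem matNorm_upperRight_le {n : ℕ} (a b c d : Matrix (Fin n) (Fin n) V) :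
    matNorm n b ≤ matNorm (n + n) (block a b c d) := by
  have e : b = (block a b c d).submatrix (Fin.castAdd n) (Fin.natAdd n) := by
    ext; simp [-Fin.natAdd_eq_addNat]
  conv_lhs => rw [e]
  exact matNorm_submatrix_le (Fin.castAdd_injective n n) (Fin.natAdd_injective n n) _

theorem matNorm_upperLeft_le {n : ℕ} (a b c d : Matrix (Fin n) (Fin n) V) :
    matNorm n a ≤ matNorm (n + n) (block a b c d) := by
  have e : a = (block a b c d).submatrix (Fin.castAdd n) (Fin.castAdd n) := by
    ext; simp [-Fin.natAdd_eq_addNat]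
  conv_lhs => rw [e]
  exact matNorm_submatrix_le (Fin.castAdd_injective n n) (Fin.castAdd_injective n n) _

theorem matNorm_lowerRight_le {n : ℕ} (a b c d : Matrix (Fin n) (Fin n) V) :
    matNorm n d ≤ matNorm (n + n) (block a b c d) := by
  have e : d = (block a b c d).submatrix (Fin.natAdd n) (Fin.natAdd n) := by
    ext; simp [-Fin.natAdd_eq_addNat]
  conv_lhs => rw [e]
  exact matNorm_submatrix_le (Fin.natAdd_injective n n) (Fin.natAdd_injective n n) _

theorem norm_entry_le {n : ℕ} (x : Matrix (Fin n) (Fin n) V) (i j : Fin n) :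
    ‖x i j‖ ≤ matNorm n x := by
  rw [← matNorm_one (x i j)]
  exact matNorm_submatrix_le (f := fun _ : Fin 1 => i) (g := fun _ => j)
    (Function.injective_of_subsingleton _) (Function.injective_of_subsingleton _) x

/-- With `norm_entry_le`, this makes convergence in M_n(V) entrywise, which is how completeness of V
reaches the matrix levels. -/
theorem matNorm_le_sum_norm {n : ℕ} (x : Matrix (Fin n) (Fin n) V) :
    matNorm n x ≤ ∑ i, ∑ j, ‖x i j‖ := by
  conv_lhs => rw [Matrix.matrix_eq_sum_single x]
  refine (matNorm_sum_le _ _).trans (Finset.sum_le_sum fun i _ => ?_)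
  refine (matNorm_sum_le _ _).trans (Finset.sum_le_sum fun j _ => ?_)
  have e : Matrix.single i j (x i j) = scalarMul (sel fun _ : Fin 1 => i)
      (Matrix.of fun _ _ => x i j) (sel fun _ : Fin 1 => j).conjTranspose := by
    ext p q
    simp only [scalarMul, sel, Matrix.single_apply, Matrix.of_apply, Matrix.conjTranspose_apply,
      Finset.univ_unique, Finset.sum_singleton]
    have h₁ : (p = i) = (i = p) := propext eq_comm
    have h₂ : (q = j) = (j = q) := propext eq_comm
    simp only [h₁, h₂]
    by_cases hp : i = p <;> by_cases hq : j = q <;> simp [hp, hq]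
  rw [e, ← matNorm_one (x i j)]
  refine matNorm_scalarMul_le_of_le_one (norm_sel_le (Function.injective_of_subsingleton _)) ?_ _
  rw [Matrix.l2_opNorm_conjTranspose]
  exact norm_sel_le (Function.injective_of_subsingleton _)

end Norms

/-! ### Positivity of block matrices. -/

section Cones

variable {V : Type*} [AddCommGroup V] [Module ℂ V] [StarAddMonoid V] [StarModule ℂ V]
  [MatrixOrdered V]

theorem submatrix_mem_cone {m n : ℕ} (f : Fin n → Fin m) {x : Matrix (Fin m) (Fin m) V}
    (hx : x ∈ cone m) : x.submatrix f f ∈ cone n := by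
  rw [← scalarMul_sel]
  exact scalarMul_mem_cone m n (sel f) x hx

theorem scalarMul_conjTranspose_mem_cone {m n : ℕ} (α : Matrix (Fin n) (Fin m) ℂ)
    {x : Matrix (Fin m) (Fin m) V} (hx : x ∈ cone m) :
    scalarMul α x α.conjTranspose ∈ cone n := by
  have := scalarMul_mem_cone m n α.conjTranspose x hx
  rwa [Matrix.conjTranspose_conjTranspose] at this

theorem block_dsum_mem_cone {m n : ℕ} (α β : Matrix (Fin n) (Fin m) ℂ)
    {a b c d : Matrix (Fin m) (Fin m) V} (h : block a b c d ∈ cone (m + m)) :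
    block (scalarMul α a α.conjTranspose) (scalarMul α b β.conjTranspose)
      (scalarMul β c α.conjTranspose) (scalarMul β d β.conjTranspose) ∈ cone (n + n) := by
  rw [← scalarMul_dsum_block, ← dsum_conjTranspose]
  exact scalarMul_conjTranspose_mem_cone _ h

theorem block_neg_mem_cone {n : ℕ} {a b c d : Matrix (Fin n) (Fin n) V}
    (h : block a b c d ∈ cone (n + n)) : block a (-b) (-c) d ∈ cone (n + n) := by
  have := block_dsum_mem_cone (1 : Matrix (Fin n) (Fin n) ℂ) ((-1 : ℂ) • 1) h
  simp only [Matrix.conjTranspose_smul, smul_scalarMul, scalarMul_smul_right,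
    Matrix.conjTranspose_one, one_scalarMul_one, smul_smul, star_neg, star_one] at this
  simpa using this

theorem block_swap_mem_cone {n : ℕ} {a b c d : Matrix (Fin n) (Fin n) V}
    (h : block a b c d ∈ cone (n + n)) : block d c b a ∈ cone (n + n) := by
  have := submatrix_mem_cone swapHalves h
  convert this using 1
  apply matrix_ext_block <;> simp [-Fin.natAdd_eq_addNat]

theorem block_dup_mem_cone {n : ℕ} {c : Matrix (Fin n) (Fin n) V} (h : c ∈ cone n) :
    block c c c c ∈ cone (n + n) := by
  have := submatrix_mem_cone (Fin.addCases id id : Fin (n + n) → Fin n) h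
  convert this using 1
  apply matrix_ext_block <;> simp [-Fin.natAdd_eq_addNat]

theorem add_half_mem_cone {n : ℕ} {x : Matrix (Fin n) (Fin n) V} (h : x + x ∈ cone n) :
    x ∈ cone n := by
  have := smul_mem_cone n (1 / 2) _ (by norm_num) h
  convert this using 1
  rw [← two_smul ℂ, smul_smul]
  norm_num

/-- If `-u ≤ v ≤ u` then `(u v; v u)` is positive. -/
theorem block_mem_cone_of_le {n : ℕ} {u v : Matrix (Fin n) (Fin n) V} (h₁ : v + u ∈ cone n)
    (h₂ : u - v ∈ cone n) : block u v v u ∈ cone (n + n) := by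
  -- The double of the block is (u + v) ⊗ (1 1; 1 1) + (u - v) ⊗ (1 -1; -1 1).
  have h := add_mem_cone _ _ _ (block_dup_mem_cone h₁) (block_neg_mem_cone (block_dup_mem_cone h₂))
  refine add_half_mem_cone ?_
  convert h using 1
  rw [block_add, block_add]
  congr 1 <;> abel

/-- Compression by the column with both blocks equal to the identity. -/
theorem add_mem_cone_of_block {n : ℕ} {a b c d : Matrix (Fin n) (Fin n) V}
    (h : block a b c d ∈ cone (n + n)) : a + b + c + d ∈ cone n := by
  have := scalarMul_mem_cone _ n (sel (Fin.castAdd n) + sel (Fin.natAdd n)) _ h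
  rw [Matrix.conjTranspose_add, add_scalarMul, scalarMul_add_right, scalarMul_add_right,
    scalarMul_sel, scalarMul_sel, scalarMul_sel, scalarMul_sel] at this
  convert this using 1
  ext i j
  simp only [Matrix.add_apply, Matrix.submatrix_apply, block_left_left, block_left_right,
    block_right_left, block_right_right]
  abel

/-- If `(a v; v b)` is positive, then so are `(a + b) / 2 ± v`. -/
theorem le_of_block_mem_cone {n : ℕ} {a b v : Matrix (Fin n) (Fin n) V}
    (h : block a v v b ∈ cone (n + n)) :
    v + (1 / 2 : ℂ) • (a + b) ∈ cone n ∧ (1 / 2 : ℂ) • (a + b) - v ∈ cone n := by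
  have key : ∀ w : Matrix (Fin n) (Fin n) V, block a w w b ∈ cone (n + n) →
      w + (1 / 2 : ℂ) • (a + b) ∈ cone n := fun w hw => by
    have := smul_mem_cone n (1 / 2) _ (by norm_num) (add_mem_cone_of_block hw)
    convert this using 1
    push_cast
    module
  refine ⟨key v h, ?_⟩
  have := key (-v) (block_neg_mem_cone h)
  rwa [neg_add_eq_sub] at this

theorem block_diag_mem_cone {m n : ℕ} {a : Matrix (Fin m) (Fin m) V} {b : Matrix (Fin n) (Fin n) V}
    (ha : a ∈ cone m) (hb : b ∈ cone n) : block a 0 0 b ∈ cone (m + n) := by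
  rw [block_diag_eq_add]
  exact add_mem_cone _ _ _ (scalarMul_conjTranspose_mem_cone (sel (Fin.castAdd n)) ha)
    (scalarMul_conjTranspose_mem_cone (sel (Fin.natAdd m)) hb)

end Cones

/-! ### Hahn–Banach theorems for ordered spaces. -/

section HahnBanach

/-- Sandwich form of the Hahn–Banach theorem: if `p` is sublinear and dominates the convex cone `R`
of pairs `(e, r)`, in the sense that `r ≤ p e`, then some linear functional lies in between. -/
theorem exists_linear_between {E : Type*} [AddCommGroup E] [Module ℝ E] (p : E → ℝ)
    (p_hom : ∀ c : ℝ, 0 < c → ∀ x, p (c • x) = c * p x) (p_add : ∀ x y, p (x + y) ≤ p x + p y)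
    (R : Set (E × ℝ)) (R_zero : 0 ∈ R) (R_add : ∀ e ∈ R, ∀ f ∈ R, e + f ∈ R)
    (R_smul : ∀ c : ℝ, 0 < c → ∀ e ∈ R, c • e ∈ R) (hR : ∀ e ∈ R, e.2 ≤ p e.1) :
    ∃ g : E →ₗ[ℝ] ℝ, (∀ x, g x ≤ p x) ∧ ∀ e ∈ R, e.2 ≤ g e.1 := by
  have : Nonempty R := ⟨⟨0, R_zero⟩⟩
  have p_zero : p 0 = 0 := by
    have := p_hom 2 two_pos 0
    rw [smul_zero] at this
    linarith
  -- N is sublinear, lies below p because 0 ∈ R, and satisfies N(-e) ≤ -r for (e, r) ∈ R. So every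
  -- linear functional below N lies in between.
  let N : E → ℝ := fun y => ⨅ e : R, p (y + e.1.1) - e.1.2
  have bdd : ∀ y, BddBelow (Set.range fun e : R => p (y + e.1.1) - e.1.2) := fun y => by
    refine ⟨-p (-y), ?_⟩
    rintro _ ⟨e, rfl⟩
    have h1 := p_add (y + e.1.1) (-y)
    have h2 := hR e.1 e.2
    rw [add_neg_cancel_comm] at h1
    simp only
    linarith
  have N_le : ∀ y, ∀ e ∈ R, N y ≤ p (y + e.1) - e.2 := fun y e he => ciInf_le (bdd y) ⟨e, he⟩
  have N_smul_le : ∀ c : ℝ, 0 < c → ∀ y, N (c • y) ≤ c * N y := fun c hc y => by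
    rw [← inv_mul_le_iff₀ hc]
    refine le_ciInf fun e => ?_
    rw [inv_mul_le_iff₀ hc]
    refine (N_le _ _ (R_smul c hc e.1 e.2)).trans (le_of_eq ?_)
    rw [Prod.smul_fst, Prod.smul_snd, ← smul_add, p_hom c hc, smul_eq_mul, mul_sub]
  have N_hom : ∀ c : ℝ, 0 < c → ∀ y, N (c • y) = c * N y := fun c hc y => by
    refine le_antisymm (N_smul_le c hc y) ?_
    have := N_smul_le c⁻¹ (inv_pos.mpr hc) (c • y)
    rwa [smul_smul, inv_mul_cancel₀ hc.ne', one_smul, le_inv_mul_iff₀ hc] at this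
  have N_add : ∀ x y, N (x + y) ≤ N x + N y := fun x y => by
    refine le_ciInf_add_ciInf fun e f => ?_
    refine (N_le _ _ (R_add e.1 e.2 f.1 f.2)).trans ?_
    have := p_add (x + e.1.1) (y + f.1.1)
    rw [add_add_add_comm] at this
    simp only [Prod.fst_add, Prod.snd_add]
    linarith
  have N_zero : N 0 = 0 := by
    have := N_hom 2 two_pos 0
    rw [smul_zero] at this
    linarith
  obtain ⟨g, -, hg⟩ := exists_extension_of_le_sublinear (⊥ : E →ₗ.[ℝ] ℝ) N N_hom N_add
    (fun x => by
      have hx : (x : E) = 0 := (Submodule.mem_bot ℝ).1 x.2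
      have hx' : x = 0 := Subtype.ext hx
      rw [hx, N_zero, hx', LinearPMap.map_zero])
  refine ⟨g, fun x => ?_, fun e he => ?_⟩
  · have := N_le x 0 R_zero
    simp only [Prod.fst_zero, Prod.snd_zero, add_zero, sub_zero] at this
    exact (hg x).trans this
  · have h1 := (hg (-e.1)).trans (N_le _ e he)
    rw [map_neg, neg_add_cancel, p_zero] at h1
    linarith

variable {M : Type*} [AddCommGroup M] [Module ℂ M] [StarAddMonoid M] [StarModule ℂ M]

theorem star_real_smul (c : ℝ) (x : M) : star (c • x) = c • star x := by
  rw [← Complex.coe_smul, ← Complex.coe_smul, star_smul]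
  congr 1
  exact Complex.conj_ofReal c

/-- Every real linear functional on a complex `*`-vector space agrees on the selfadjoint part with
a selfadjoint complex linear functional. -/
theorem exists_selfAdjoint_functional (g : M →ₗ[ℝ] ℝ) :
    ∃ φ : M →ₗ[ℂ] ℂ, (∀ x, φ (star x) = star (φ x)) ∧
      ∀ x, (φ x).re = (g x + g (star x)) / 2 := by
  let st : M →ₗ[ℝ] M :=
    { toFun := star
      map_add' := star_add
      map_smul' := star_real_smul }
  let h : M →ₗ[ℝ] ℝ := (1 / 2 : ℝ) • (g + g ∘ₗ st)
  have hval : ∀ x, h x = (g x + g (star x)) / 2 := fun x => by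
    simp only [h, st, LinearMap.smul_apply, LinearMap.add_apply, LinearMap.comp_apply,
      LinearMap.coe_mk, AddHom.coe_mk, smul_eq_mul]
    ring
  have hstar : ∀ x, h (star x) = h x := fun x => by
    rw [hval, hval, star_star, add_comm]
  let φ : M →ₗ[ℂ] ℂ := Module.Dual.extendRCLike (𝕜 := ℂ) h
  have hφ : ∀ x, φ x = (h x : ℂ) - Complex.I * (h (Complex.I • x) : ℂ) := fun x =>
    Module.Dual.extendRCLike_apply h x
  refine ⟨φ, fun x => ?_, fun x => ?_⟩
  · have e : h (Complex.I • star x) = -h (Complex.I • x) := by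
      rw [← map_neg, ← hstar (-(Complex.I • x))]
      congr 1
      simp [star_smul]
    rw [hφ, hφ, hstar, e]
    simp
  · rw [hφ, ← hval]
    simp

/-- Duality for the p-distance from v to -C, of which s is a lower bound. The sandwich theorem is
applied to the cone generated by C × {0} and (v, s), which encodes both positivity on C and the
value at v. -/
theorem exists_positive_functional (p : Seminorm ℂ M) (p_star : ∀ x, p (star x) = p x)
    (C : Set M) (C_zero : 0 ∈ C) (C_add : ∀ x ∈ C, ∀ y ∈ C, x + y ∈ C)
    (C_smul : ∀ c : ℝ, 0 < c → ∀ x ∈ C, (c : ℂ) • x ∈ C) (C_star : ∀ x ∈ C, star x = x)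
    {v : M} (hv : star v = v) {s : ℝ} (hs : ∀ c ∈ C, s ≤ p (v + c)) :
    ∃ φ : M →ₗ[ℂ] ℂ, (∀ x, φ (star x) = star (φ x)) ∧ (∀ x ∈ C, 0 ≤ φ x) ∧
      (∀ x, ‖φ x‖ ≤ p x) ∧ s ≤ ‖φ v‖ := by
  have p_real : ∀ c : ℝ, 0 < c → ∀ x, p (c • x) = c * p x := fun c hc x => by
    rw [← Complex.coe_smul, map_smul_eq_mul, Complex.norm_real, Real.norm_of_nonneg hc.le]
  obtain ⟨g, hg, hgR⟩ := exists_linear_between p p_real (map_add_le_add p)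
    {e | ∃ c ∈ C, ∃ t : ℝ, 0 ≤ t ∧ e = (c + t • v, t * s)}
    ⟨0, C_zero, 0, le_rfl, by simp [Prod.zero_eq_mk]⟩
    (by
      rintro _ ⟨c, hc, t, ht, rfl⟩ _ ⟨c', hc', t', ht', rfl⟩
      refine ⟨c + c', C_add c hc c' hc', t + t', add_nonneg ht ht', ?_⟩
      rw [Prod.mk_add_mk, add_smul, add_mul]
      congr 1
      abel)
    (by
      rintro r hr _ ⟨c, hc, t, ht, rfl⟩
      refine ⟨(r : ℂ) • c, C_smul r hr c hc, r * t, by positivity, ?_⟩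
      rw [Prod.smul_mk, smul_add, smul_smul, smul_eq_mul, mul_assoc, Complex.coe_smul])
    (by
      rintro _ ⟨c, hc, t, ht, rfl⟩
      rcases ht.eq_or_lt with rfl | ht
      · simp
      · have h1 := hs _ (C_smul t⁻¹ (inv_pos.mpr ht) c hc)
        have h2 := p_real t ht (v + ((t⁻¹ : ℝ) : ℂ) • c)
        rw [smul_add, Complex.coe_smul, smul_smul, mul_inv_cancel₀ ht.ne', one_smul,
          add_comm] at h2
        rw [Complex.coe_smul] at h1
        simp only
        rw [h2]
        gcongr)
  obtain ⟨φ, hφ, hre⟩ := exists_selfAdjoint_functional g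
  have hsa : ∀ x, star x = x → φ x = (g x : ℂ) := fun x hx => by
    have h1 := hφ x
    rw [hx] at h1
    have h2 := hre x
    rw [hx] at h2
    rw [← Complex.conj_eq_iff_re.mp h1.symm, h2]
    push_cast
    ring
  have hle : ∀ x, (φ x).re ≤ p x := fun x => by
    have h1 := hg x
    have h2 := hg (star x)
    rw [p_star] at h2
    rw [hre]
    linarith
  refine ⟨φ, hφ, fun x hx => ?_, fun x => ?_, ?_⟩
  · rw [hsa x (C_star x hx)]
    have := hgR (x, 0) ⟨x, hx, 0, le_rfl, by simp⟩
    exact_mod_cast this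
  -- A rotation of x turns the bound on the real part into a bound on the modulus.
  · obtain ⟨c, hc, h⟩ : ∃ c : ℂ, ‖c‖ = 1 ∧ (‖φ x‖ : ℂ) = c * φ x := by
      rcases eq_or_ne (φ x) 0 with h0 | h0
      · exact ⟨1, by simp, by simp [h0]⟩
      · refine ⟨‖φ x‖ / φ x, ?_, ?_⟩
        · rw [norm_div, Complex.norm_real, norm_norm, div_self (norm_ne_zero_iff.mpr h0)]
        · rw [div_mul_cancel₀ _ h0]
    have h1 := hle (c • x)
    rwa [map_smul, smul_eq_mul, ← h, map_smul_eq_mul, hc, one_mul, Complex.ofReal_re] at h1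
  · have h1 := hgR (v, s) ⟨0, C_zero, 1, zero_le_one, by simp⟩
    rw [hsa v hv, Complex.norm_real]
    exact h1.trans (Real.le_norm_self _)

end HahnBanach

theorem block_offDiag_isHermitian {X : Type*} [AddCommGroup X] [StarAddMonoid X] {n : ℕ}
    (x : Matrix (Fin n) (Fin n) X) : (block 0 x x.conjTranspose 0).IsHermitian := by
  rw [Matrix.IsHermitian, block_conjTranspose]
  simp

/-! ### Operator systems are the normally ordered spaces. -/

section OperatorSystems

variable (X : Type*) [NormedAddCommGroup X] [NormedSpace ℂ X] [StarAddMonoid X]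
  [StarModule ℂ X] [MatrixOrderedOperatorSpace X]

/-- The order is normal with constant `k`: if `(0 x; x^* 0) ≤ z`, then `‖x‖ ≤ k ‖z‖`. -/
def IsNormal (k : ℝ) : Prop :=
  ∀ (n : ℕ) (x : Matrix (Fin n) (Fin n) X) (z : Matrix (Fin (n + n)) (Fin (n + n)) X),
    z - block 0 x x.conjTranspose 0 ∈ cone (n + n) → matNorm n x ≤ k * matNorm (n + n) z

variable {X}

/-- The norm of `M_n(X)` as a seminorm. -/
def matSeminorm (X : Type*) [NormedAddCommGroup X] [NormedSpace ℂ X] [OperatorSpace X] (n : ℕ) :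
    Seminorm ℂ (Matrix (Fin n) (Fin n) X) :=
  Seminorm.of (matNorm n) (matNorm_add_le n) (matNorm_smul n)

theorem IsPosContractive.re_le {n : ℕ} {φ : Matrix (Fin n) (Fin n) X →ₗ[ℂ] ℂ}
    (hφ : IsPosContractive φ) {v z : Matrix (Fin n) (Fin n) X} (h : z - v ∈ cone n) :
    (φ v).re ≤ matNorm n z := by
  have h1 := hφ.nonneg _ h
  rw [map_sub, Complex.le_def] at h1
  have h2 := h1.1
  simp only [Complex.zero_re, Complex.sub_re] at h2
  have h3 := (Complex.re_le_norm _).trans (hφ.norm_le z)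
  linarith

theorem IsPosContractive.norm_eq_abs_re {n : ℕ} {φ : Matrix (Fin n) (Fin n) X →ₗ[ℂ] ℂ}
    (hφ : IsPosContractive φ) {v : Matrix (Fin n) (Fin n) X} (h : v.IsHermitian) :
    ‖φ v‖ = |(φ v).re| := by
  have h1 := hφ.selfAdjoint v
  rw [h.eq] at h1
  rw [← Complex.conj_eq_iff_re.mp h1.symm, Complex.norm_real, Complex.ofReal_re, Real.norm_eq_abs]

theorem IsPosContractive.norm_offDiag_le {n : ℕ}
    {φ : Matrix (Fin (n + n)) (Fin (n + n)) X →ₗ[ℂ] ℂ} (hφ : IsPosContractive φ)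
    {x : Matrix (Fin n) (Fin n) X} {z : Matrix (Fin (n + n)) (Fin (n + n)) X}
    (h : z - block 0 x x.conjTranspose 0 ∈ cone (n + n)) :
    ‖φ (block 0 x x.conjTranspose 0)‖ ≤ matNorm (n + n) z := by
  rw [hφ.norm_eq_abs_re (block_offDiag_isHermitian x), abs_le]
  refine ⟨?_, hφ.re_le h⟩
  obtain ⟨a, b, c, d, rfl⟩ : ∃ a b c d, z = block a b c d := ⟨_, _, _, _, eq_block z⟩
  -- Lower bound: the sign flip dominates the negative of the off-diagonal matrix by an element of
  -- no larger norm.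
  have h1 : block a (-b) (-c) d - -block 0 x x.conjTranspose 0 ∈ cone (n + n) := by
    rw [block_sub] at h
    have := block_neg_mem_cone h
    convert this using 1
    rw [block_neg, block_sub]
    congr 1 <;> abel
  have h2 := hφ.re_le h1
  rw [map_neg, Complex.neg_re] at h2
  have h3 := matNorm_block_neg_le a b c d
  linarith

/-- Normality says precisely that ‖x‖ / k is a lower bound for the distance from (0 x; x^* 0) to the
negative cone. -/
theorem matNorm_le_numRadius {k : ℝ} (hk : 0 < k) (h : IsNormal X k) {n : ℕ}
    (x : Matrix (Fin n) (Fin n) X) : matNorm n x ≤ k * numRadius x := by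
  obtain ⟨φ, h1, h2, h3, h4⟩ := exists_positive_functional (matSeminorm X (n + n))
    (fun x => matNorm_conjTranspose _ x) (cone (n + n)) (zero_mem_cone _)
    (fun x hx y hy => add_mem_cone _ x y hx hy) (fun c hc x hx => smul_mem_cone _ c x hc.le hx)
    (fun x hx => isHermitian_of_mem_cone _ x hx) (block_offDiag_isHermitian x)
    (s := matNorm n x / k) (fun c hc => by
      rw [div_le_iff₀' hk]
      refine h n x _ ?_
      rwa [add_sub_cancel_left])
  rw [← div_le_iff₀' hk]
  refine le_csSup_of_le ⟨matNorm (n + n) (block 0 x x.conjTranspose 0), ?_⟩ ⟨φ, ⟨h1, h2, h3⟩, rfl⟩ h4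
  rintro _ ⟨ψ, hψ, rfl⟩
  exact hψ.norm_le _

/-- A positive contraction φ satisfies φ(v) ≤ φ(z) ≤ ‖z‖ when v ≤ z, so the numerical radius is at
most ‖z‖. The other direction is Hahn–Banach, together with normality at z = 0 for properness. -/
theorem isOperatorSystem_iff : IsOperatorSystem X ↔ ∃ k : ℝ, 0 < k ∧ IsNormal X k := by
  constructor
  · rintro ⟨-, k, hk, h⟩
    refine ⟨k, hk, fun n x z hz => (h n x).trans ?_⟩
    gcongr
    refine Real.sSup_le ?_ (matNorm_nonneg _ _)
    rintro _ ⟨φ, hφ, rfl⟩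
    exact hφ.norm_offDiag_le hz
  · rintro ⟨k, hk, h⟩
    refine ⟨fun n x hx hx' => ?_, k, hk, fun n x => matNorm_le_numRadius hk h x⟩
    refine eq_zero_of_matNorm n x (le_antisymm ?_ (matNorm_nonneg n x))
    -- (0 -x; -x 0) is the sum of the positive matrices (x -x; -x x) and (-x 0; 0 -x).
    have hz : (0 : Matrix (Fin (n + n)) (Fin (n + n)) X) - block 0 x x.conjTranspose 0
        ∈ cone (n + n) := by
      rw [(isHermitian_of_mem_cone n x hx).eq]
      have := add_mem_cone _ _ _ (block_neg_mem_cone (block_dup_mem_cone hx))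
        (block_diag_mem_cone hx' hx')
      convert this using 1
      rw [zero_sub, block_neg, block_add]
      simp
    have := h n x 0 hz
    rwa [matNorm_zero, mul_zero] at this

end OperatorSystems

/-! ### Estimates for scalar matrices. -/

section ScalarMatrices

variable {ι κ : Type*} [Fintype ι] [Fintype κ]

theorem norm_dotProduct_star_le (ξ η : ι → ℂ) :
    ‖star ξ ⬝ᵥ η‖ ≤ √(∑ i, ‖ξ i‖ ^ 2) * √(∑ i, ‖η i‖ ^ 2) := by
  refine (norm_sum_le _ _).trans (le_trans (le_of_eq ?_) (Real.sum_mul_le_sqrt_mul_sqrt _ _ _))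
  simp

theorem dotProduct_star_self_eq (ξ : ι → ℂ) : star ξ ⬝ᵥ ξ = ((∑ i, ‖ξ i‖ ^ 2 : ℝ) : ℂ) := by
  push_cast
  exact Finset.sum_congr rfl fun i _ => Complex.conj_mul' (ξ i)

variable [DecidableEq κ]

theorem norm_sesquilinear_le (A : Matrix ι κ ℂ) (ξ : ι → ℂ) (η : κ → ℂ) :
    ‖star ξ ⬝ᵥ A.mulVec η‖ ≤ ‖A‖ * (√(∑ i, ‖ξ i‖ ^ 2) * √(∑ j, ‖η j‖ ^ 2)) := by
  refine (norm_dotProduct_star_le _ _).trans ?_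
  have h := Real.sqrt_le_sqrt (sum_norm_mulVec_sq_le A η)
  rw [Real.sqrt_mul (by positivity), Real.sqrt_sq (norm_nonneg _)] at h
  calc _ ≤ √(∑ i, ‖ξ i‖ ^ 2) * (‖A‖ * √(∑ j, ‖η j‖ ^ 2)) := by gcongr
    _ = _ := by ring

theorem l2_norm_le_of_re_le {A : Matrix ι κ ℂ} {c : ℝ} (hc : 0 ≤ c)
    (h : ∀ (ξ : ι → ℂ) (η : κ → ℂ),
      2 * (star ξ ⬝ᵥ A.mulVec η).re ≤ c * (∑ i, ‖ξ i‖ ^ 2 + ∑ j, ‖η j‖ ^ 2)) : ‖A‖ ≤ c := by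
  refine l2_norm_le hc fun η => ?_
  -- Test with ξ = t A η. The choice t = 1/c gives ‖Aη‖² ≤ c²‖η‖², and t = 1 settles c = 0.
  have key : ∀ t : ℝ, 2 * (t * ∑ i, ‖A.mulVec η i‖ ^ 2)
      ≤ c * (t ^ 2 * ∑ i, ‖A.mulVec η i‖ ^ 2 + ∑ j, ‖η j‖ ^ 2) := fun t => by
    have h1 := h ((t : ℂ) • A.mulVec η) η
    rw [star_smul, smul_dotProduct, dotProduct_star_self_eq] at h1
    have e1 : (star (t : ℂ) • ((∑ i, ‖A.mulVec η i‖ ^ 2 : ℝ) : ℂ)).re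
        = t * ∑ i, ‖A.mulVec η i‖ ^ 2 := by
      rw [smul_eq_mul, Complex.star_def, Complex.conj_ofReal, ← Complex.ofReal_mul,
        Complex.ofReal_re]
    have e2 : ∑ i, ‖((t : ℂ) • A.mulVec η) i‖ ^ 2 = t ^ 2 * ∑ i, ‖A.mulVec η i‖ ^ 2 := by
      rw [Finset.mul_sum]
      refine Finset.sum_congr rfl fun i _ => ?_
      rw [Pi.smul_apply, norm_smul, Complex.norm_real, mul_pow, Real.norm_eq_abs, sq_abs]
    rwa [e1, e2] at h1
  rcases hc.eq_or_lt with rfl | hc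
  · have := key 1
    linarith
  · have h1 := key c⁻¹
    have h2 := mul_le_mul_of_nonneg_left h1 hc.le
    field_simp at h2
    linarith

theorem re_quadratic_le (A : Matrix κ κ ℂ) (ξ : κ → ℂ) {c : ℝ} (hA : ‖A‖ ≤ c) :
    (star ξ ⬝ᵥ A.mulVec ξ).re ≤ c * ∑ i, ‖ξ i‖ ^ 2 := by
  refine (Complex.re_le_norm _).trans ((norm_sesquilinear_le A ξ ξ).trans ?_)
  rw [Real.mul_self_sqrt (by positivity)]
  gcongr

/-- The off-diagonal corner of a positive block matrix is dominated by the diagonal. -/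
theorem norm_corner_le_of_posSemidef {A : Matrix ι ι ℂ} {B : Matrix ι κ ℂ} {C : Matrix κ ι ℂ}
    {D : Matrix κ κ ℂ} [DecidableEq ι] {c : ℝ} (hc : 0 ≤ c)
    (h : (Matrix.fromBlocks A B C D).PosSemidef) (hA : ‖A‖ ≤ c) (hD : ‖D‖ ≤ c) : ‖B‖ ≤ c := by
  -- Positivity at (ξ, η) bounds Re⟨ξ, Bη⟩ from below, hence the passage to -B.
  rw [← norm_neg]
  refine l2_norm_le_of_re_le hc fun ξ η => ?_
  have h1 := (h.dotProduct_mulVec_nonneg (Sum.elim ξ η))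
  have hC : C = B.conjTranspose := by
    have := h.1
    rw [Matrix.IsHermitian, Matrix.fromBlocks_conjTranspose, Matrix.fromBlocks_inj] at this
    exact this.2.2.1.symm
  have e : star (Sum.elim ξ η) ⬝ᵥ (Matrix.fromBlocks A B C D).mulVec (Sum.elim ξ η)
      = (star ξ ⬝ᵥ A.mulVec ξ + star ξ ⬝ᵥ B.mulVec η) + (star η ⬝ᵥ C.mulVec ξ
        + star η ⬝ᵥ D.mulVec η) := by
    rw [Matrix.fromBlocks_mulVec, ← dotProduct_add, ← dotProduct_add]
    simp [dotProduct, Function.comp_def]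
  have e2 : star η ⬝ᵥ C.mulVec ξ = star (star ξ ⬝ᵥ B.mulVec η) := by
    rw [hC, Matrix.star_dotProduct, Matrix.star_mulVec, Matrix.conjTranspose_conjTranspose,
      Matrix.dotProduct_mulVec]
  rw [e, e2, Complex.le_def] at h1
  have h2 := h1.1
  have h3 := re_quadratic_le A ξ hA
  have h4 := re_quadratic_le D η hD
  simp only [Complex.zero_re, Complex.add_re, Complex.star_def, Complex.conj_re] at h2
  rw [Matrix.neg_mulVec, dotProduct_neg, Complex.neg_re]
  linarith

end ScalarMatrices

/-! ### Generation, monotonicity and normality. -/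

section Normality

variable (V : Type*) [NormedAddCommGroup V] [NormedSpace ℂ V] [StarAddMonoid V]
  [StarModule ℂ V] [MatrixOrderedOperatorSpace V]

/-- The cones are generating with constant `K`. -/
def IsGenerating (K : ℝ) : Prop :=
  ∀ (n : ℕ) (x : Matrix (Fin n) (Fin n) V), ∃ a b : Matrix (Fin n) (Fin n) V,
    block a x x.conjTranspose b ∈ cone (n + n) ∧ matNorm n a ≤ K * matNorm n x ∧
      matNorm n b ≤ K * matNorm n x

/-- The norm is monotone with constant `k`. -/
def IsMonotone (k : ℝ) : Prop :=
  ∀ (n : ℕ) (v u : Matrix (Fin n) (Fin n) V), v.IsHermitian → u ∈ cone n →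
    v + u ∈ cone n → u - v ∈ cone n → matNorm n v ≤ k * matNorm n u

variable {V}

theorem mem_cone_of_le {n : ℕ} {u v : Matrix (Fin n) (Fin n) V} (h₁ : v + u ∈ cone n)
    (h₂ : u - v ∈ cone n) : u ∈ cone n := by
  refine add_half_mem_cone ?_
  convert add_mem_cone _ _ _ h₁ h₂ using 1
  abel

theorem matNorm_half_add_le {n : ℕ} {a b : Matrix (Fin n) (Fin n) V} {t : ℝ}
    (ha : matNorm n a ≤ t) (hb : matNorm n b ≤ t) : matNorm n ((1 / 2 : ℂ) • (a + b)) ≤ t := by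
  rw [matNorm_smul]
  have h := matNorm_add_le n a b
  have e : ‖(1 / 2 : ℂ)‖ = 1 / 2 := by norm_num
  rw [e]
  linarith

theorem IsGenerating.exists_ge {K : ℝ} (h : IsGenerating V K) {n : ℕ}
    {z : Matrix (Fin n) (Fin n) V} (hz : z.IsHermitian) :
    ∃ u, z + u ∈ cone n ∧ u - z ∈ cone n ∧ matNorm n u ≤ K * matNorm n z := by
  obtain ⟨a, b, h1, ha, hb⟩ := h n z
  rw [hz.eq] at h1
  obtain ⟨h2, h3⟩ := le_of_block_mem_cone h1
  exact ⟨_, h2, h3, matNorm_half_add_le ha hb⟩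

/-- Adding the sign flip of the second inequality to the first cancels b and c, which leaves exactly
x in the corner. -/
theorem block_mem_cone_of_le_offDiag {n : ℕ} {a b c d x : Matrix (Fin n) (Fin n) V}
    (h₁ : block 0 x x.conjTranspose 0 + block a b c d ∈ cone (n + n))
    (h₂ : block a b c d - block 0 x x.conjTranspose 0 ∈ cone (n + n)) :
    block a x x.conjTranspose d ∈ cone (n + n) := by
  rw [block_add] at h₁
  rw [block_sub] at h₂
  refine add_half_mem_cone ?_
  convert add_mem_cone _ _ _ h₁ (block_neg_mem_cone h₂) using 1
  rw [block_add, block_add]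
  congr 1 <;> abel

/-- The hypothesis v ≤ z is one-sided and z need not be positive. A sign flip z' gives -v ≤ z'. If u
and u' dominate ±z and ±z', then ±v ≤ u + u' and monotonicity applies; the factor 2 counts u and u'.
-/
theorem IsGenerating.isNormal {K k : ℝ} (hk : 0 ≤ k) (hG : IsGenerating V K)
    (hM : IsMonotone V k) : IsNormal V (2 * k * K) := by
  intro n x z hz
  set v := block 0 x x.conjTranspose 0 with hv
  have hvH : v.IsHermitian := block_offDiag_isHermitian x
  have hzH : z.IsHermitian := by
    have := (isHermitian_of_mem_cone _ _ hz).add hvH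
    rwa [sub_add_cancel] at this
  obtain ⟨z', hz'H, hz'n, hz'⟩ : ∃ z', z'.IsHermitian ∧ matNorm (n + n) z' ≤ matNorm (n + n) z ∧
      z' + v ∈ cone (n + n) := by
    obtain ⟨a, b, c, d, rfl⟩ : ∃ a b c d, z = block a b c d := ⟨_, _, _, _, eq_block z⟩
    have h1 : block a (-b) (-c) d + v ∈ cone (n + n) := by
      rw [hv, block_sub] at hz
      convert block_neg_mem_cone hz using 1
      rw [hv, block_add]
      congr 1 <;> abel
    refine ⟨block a (-b) (-c) d, ?_, matNorm_block_neg_le _ _ _ _, h1⟩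
    have := (isHermitian_of_mem_cone _ _ h1).sub hvH
    rwa [add_sub_cancel_right] at this
  obtain ⟨u, h1, h2, h3⟩ := hG.exists_ge hzH
  obtain ⟨u', h1', h2', h3'⟩ := hG.exists_ge hz'H
  have a1 : v + (u + u') ∈ cone (n + n) := by
    convert add_mem_cone _ _ _ (add_mem_cone _ _ _ h2' hz') (mem_cone_of_le h1 h2) using 1
    abel
  have a2 : u + u' - v ∈ cone (n + n) := by
    convert add_mem_cone _ _ _ (add_mem_cone _ _ _ h2 hz) (mem_cone_of_le h1' h2') using 1
    abel
  have h4 := hM _ v (u + u') hvH (mem_cone_of_le a1 a2) a1 a2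
  have h5 := matNorm_upperRight_le 0 x x.conjTranspose 0
  have h6 := matNorm_add_le _ u u'
  rcases le_or_gt 0 K with hK | hK
  · calc matNorm n x ≤ k * matNorm (n + n) (u + u') := h5.trans h4
      _ ≤ k * (K * matNorm (n + n) z + K * matNorm (n + n) z) := by
        refine mul_le_mul_of_nonneg_left (h6.trans (add_le_add h3 (h3'.trans ?_))) hk
        gcongr
      _ = _ := by ring
  -- A negative K is possible only when the norms in question vanish.
  · have h7 : matNorm (n + n) z ≤ 0 := by
      nlinarith [matNorm_nonneg _ u, matNorm_nonneg _ z]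
    have h8 : matNorm (n + n) z' = 0 := le_antisymm (hz'n.trans h7) (matNorm_nonneg _ _)
    have h9 : matNorm (n + n) z = 0 := le_antisymm h7 (matNorm_nonneg _ _)
    rw [h9, mul_zero] at h3 ⊢
    rw [h8, mul_zero] at h3'
    refine (h5.trans h4).trans ?_
    nlinarith

theorem IsGenerating.isNormal_dual {K : ℝ} (hK : 0 ≤ K) (hG : IsGenerating V K) :
    IsNormal (OpDual V) (K + 1) := by
  intro n F z hz
  obtain ⟨z₁, z₂, z₃, z₄, rfl⟩ : ∃ a b c d, z = block a b c d := ⟨_, _, _, _, eq_block z⟩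
  set N := matNorm (n + n) (block z₁ z₂ z₃ z₄) with hN
  have hN0 : 0 ≤ N := matNorm_nonneg _ _
  refine cbNorm_le (by positivity) fun m x => ?_
  have hx0 := matNorm_nonneg m x
  obtain ⟨a, b, hab, ha, hb⟩ := hG m x
  have h1 := hz.2 _ _ hab
  -- Keep the index pairs whose two components lie in the same half. This compression has z₂ - F
  -- evaluated at x in its corner.
  let f : (Fin m × Fin n) ⊕ (Fin m × Fin n) → Fin (m + m) × Fin (n + n) :=
    Sum.elim (fun p => (Fin.castAdd m p.1, Fin.castAdd n p.2))
      (fun p => (Fin.natAdd m p.1, Fin.natAdd n p.2))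
  have h2 := h1.submatrix f
  have e : (amp (block z₁ z₂ z₃ z₄ - block 0 F F.conjTranspose 0)
      (block a x x.conjTranspose b)).submatrix f f
      = Matrix.fromBlocks (amp z₁ a) (amp (z₂ - F) x) (amp (z₃ - F.conjTranspose) x.conjTranspose)
        (amp z₄ b) := by
    rw [block_sub]
    ext p q
    rcases p with p | p <;> rcases q with q | q <;>
      simp [f, amp, Matrix.fromBlocks, -Fin.natAdd_eq_addNat]
  rw [e] at h2
  have bound : ∀ (w : Matrix (Fin n) (Fin n) (OpDual V)) (y : Matrix (Fin m) (Fin m) V),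
      matNorm n w ≤ N → matNorm m y ≤ K * matNorm m x → ‖amp w y‖ ≤ N * (K * matNorm m x) :=
    fun w y hw hy => (cbBound_cbNorm w m y).trans (mul_le_mul hw hy (matNorm_nonneg _ _) hN0)
  have h3 := norm_corner_le_of_posSemidef (by positivity) h2
    (bound z₁ a (matNorm_upperLeft_le _ _ _ _) ha) (bound z₄ b (matNorm_lowerRight_le _ _ _ _) hb)
  -- The corner estimate controls only z₂ - F; the summand 1 in K + 1 pays for z₂.
  have h4 : ‖amp z₂ x‖ ≤ N * matNorm m x := (cbBound_cbNorm z₂ m x).trans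
    (mul_le_mul_of_nonneg_right (matNorm_upperRight_le z₁ z₂ z₃ z₄) hx0)
  rw [amp_sub, norm_sub_rev] at h3
  have h5 := norm_add_le (amp F x - amp z₂ x) (amp z₂ x)
  rw [sub_add_cancel] at h5
  calc ‖amp F x‖ ≤ N * (K * matNorm m x) + N * matNorm m x := h5.trans (add_le_add h3 h4)
    _ = _ := by ring

end Normality

/-! ### From a matrix regular space to operator systems. -/

section Transfer

variable {V W : Type*} [NormedAddCommGroup V] [NormedSpace ℂ V] [StarAddMonoid V]
  [StarModule ℂ V] [MatrixOrderedOperatorSpace V] [NormedAddCommGroup W] [NormedSpace ℂ W]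
  [StarAddMonoid W] [StarModule ℂ W] [MatrixOrderedOperatorSpace W]

theorem IsCompletelyBounded.exists_nonneg {Φ : V →ₗ[ℂ] W} (h : IsCompletelyBounded Φ) :
    ∃ c : ℝ, 0 ≤ c ∧ ∀ (n : ℕ) (x : Matrix (Fin n) (Fin n) V),
      matNorm n (x.map Φ) ≤ c * matNorm n x := by
  obtain ⟨c, hc⟩ := h
  refine ⟨|c|, abs_nonneg c, fun n x => (hc n x).trans ?_⟩
  exact mul_le_mul_of_nonneg_right (le_abs_self c) (matNorm_nonneg n x)

theorem IsCompletelyPositive.map_conjTranspose {Φ : V →ₗ[ℂ] W} (h : IsCompletelyPositive Φ)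
    {n : ℕ} (x : Matrix (Fin n) (Fin n) V) :
    x.conjTranspose.map Φ = (x.map Φ).conjTranspose := by
  ext i j
  simp [h.map_star]

theorem IsMatrixRegular.exists_ge (h : IsMatrixRegular W) {n : ℕ} {y : Matrix (Fin n) (Fin n) W}
    (hy : y.IsHermitian) :
    ∃ u, y + u ∈ cone n ∧ u - y ∈ cone n ∧ matNorm n u ≤ 2 * matNorm n y := by
  rcases (matNorm_nonneg n y).eq_or_lt with h0 | h0
  · have := eq_zero_of_matNorm n y h0.symm
    subst this
    exact ⟨0, by simpa using zero_mem_cone n, by simpa using zero_mem_cone n, by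
      simp [matNorm_zero]⟩
  -- Division by t gives norm 1/2, so the strict bound of regularity applies. This is the source of
  -- the factor 2.
  · set t : ℝ := 2 * matNorm n y with ht
    have ht0 : 0 < t := by positivity
    have hyH : (((t⁻¹ : ℝ) : ℂ) • y).IsHermitian := by
      rw [Matrix.IsHermitian, Matrix.conjTranspose_smul, hy.eq, Complex.star_def,
        Complex.conj_ofReal]
    have hlt : matNorm n (((t⁻¹ : ℝ) : ℂ) • y) < 1 := by
      rw [matNorm_smul, Complex.norm_real, Real.norm_of_nonneg (by positivity),
        inv_mul_lt_iff₀ ht0]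
      linarith
    obtain ⟨u, -, hun, h1, h2⟩ := h.exists_bound n _ hyH hlt
    have hs : (t : ℂ) • ((t⁻¹ : ℝ) : ℂ) • y = y := by
      rw [smul_smul, ← Complex.ofReal_mul, mul_inv_cancel₀ ht0.ne', Complex.ofReal_one, one_smul]
    refine ⟨(t : ℂ) • u, ?_, ?_, ?_⟩
    · have := smul_mem_cone n t _ ht0.le h1
      rwa [smul_add, hs] at this
    · have := smul_mem_cone n t _ ht0.le h2
      rwa [smul_sub, hs] at this
    · rw [matNorm_smul, Complex.norm_real, Real.norm_of_nonneg ht0.le]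
      exact mul_le_of_le_one_right ht0.le hun.le

theorem IsCompleteOrderIso.isMonotone {Φ : V ≃ₗ[ℂ] W} (hΦ : IsCompleteOrderIso Φ)
    (hW : IsMatrixRegular W) : ∃ k, 0 ≤ k ∧ IsMonotone V k := by
  obtain ⟨c, hc0, hc⟩ := hΦ.cb.exists_nonneg
  obtain ⟨d, hd0, hd⟩ := hΦ.cb_symm.exists_nonneg
  refine ⟨d * c, by positivity, fun n v u hv hu h1 h2 => ?_⟩
  have e : (v.map Φ).map Φ.symm = v := by ext; simp
  have h3 := hW.norm_le n (v.map Φ) (u.map Φ)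
    (by
      have := hΦ.cp.map_conjTranspose v
      rw [hv.eq] at this
      exact this.symm)
    (hΦ.cp.map_cone n u hu)
    (by
      convert hΦ.cp.map_cone n _ h1 using 1
      ext; simp)
    (by
      convert hΦ.cp.map_cone n _ h2 using 1
      ext; simp)
  have h4 := hd n (v.map Φ)
  have h5 := hc n u
  calc matNorm n v ≤ d * matNorm n (v.map Φ) := by
        conv_lhs => rw [← e]
        exact h4
    _ ≤ d * (c * matNorm n u) := mul_le_mul_of_nonneg_left (h3.trans h5) hd0
    _ = _ := by ring

/-- Regularity only dominates selfadjoint elements, so it is applied to (0 x; x^* 0), one matrix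
size up. -/
theorem IsCompleteOrderIso.isGenerating {Φ : V ≃ₗ[ℂ] W} (hΦ : IsCompleteOrderIso Φ)
    (hW : IsMatrixRegular W) : ∃ K, 0 ≤ K ∧ IsGenerating V K := by
  obtain ⟨c, hc0, hc⟩ := hΦ.cb.exists_nonneg
  obtain ⟨d, hd0, hd⟩ := hΦ.cb_symm.exists_nonneg
  refine ⟨d * (2 * c), by positivity, fun n x => ?_⟩
  set v := block 0 x x.conjTranspose 0 with hv
  have hvH : v.IsHermitian := block_offDiag_isHermitian x
  have hvn : matNorm (n + n) v ≤ matNorm n x := by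
    refine (matNorm_block_le _ _ _ _).trans ?_
    rw [matNorm_zero, matNorm_conjTranspose]
    simp
  have e : (v.map Φ).map Φ.symm = v := by ext; simp
  obtain ⟨u, h1, h2, h3⟩ := hW.exists_ge (y := v.map Φ) (by
      have := hΦ.cp.map_conjTranspose v
      rw [hvH.eq] at this
      exact this.symm)
  have h1' := hΦ.cp_symm.map_cone _ _ h1
  have h2' := hΦ.cp_symm.map_cone _ _ h2
  have e1 : (v.map Φ + u).map Φ.symm = v + u.map Φ.symm := by ext; simp
  have e2 : (u - v.map Φ).map Φ.symm = u.map Φ.symm - v := by ext; simp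
  have h1'' : v + u.map Φ.symm ∈ cone (n + n) := e1 ▸ h1'
  have h2'' : u.map Φ.symm - v ∈ cone (n + n) := e2 ▸ h2'
  have hn : matNorm (n + n) (u.map Φ.symm) ≤ d * (2 * c) * matNorm n x := by
    calc matNorm (n + n) (u.map Φ.symm) ≤ d * matNorm (n + n) u := hd _ u
      _ ≤ d * (2 * (c * matNorm (n + n) v)) := by
        refine mul_le_mul_of_nonneg_left (h3.trans ?_) hd0
        exact mul_le_mul_of_nonneg_left (hc _ v) two_pos.le
      _ ≤ d * (2 * (c * matNorm n x)) := by gcongr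
      _ = _ := by ring
  obtain ⟨a, b, c', d', he⟩ : ∃ a b c d, u.map Φ.symm = block a b c d := ⟨_, _, _, _, eq_block _⟩
  rw [he] at h1'' h2'' hn
  exact ⟨a, d', block_mem_cone_of_le_offDiag h1'' h2'', (matNorm_upperLeft_le _ _ _ _).trans hn,
    (matNorm_lowerRight_le _ _ _ _).trans hn⟩

theorem IsCompleteOrderIso.isOperatorSystem {Φ : V ≃ₗ[ℂ] W} (hΦ : IsCompleteOrderIso Φ)
    (hW : IsMatrixRegular W) : IsOperatorSystem V ∧ IsOperatorSystem (OpDual V) := by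
  obtain ⟨K, hK, hG⟩ := hΦ.isGenerating hW
  obtain ⟨k, hk, hM⟩ := hΦ.isMonotone hW
  refine ⟨isOperatorSystem_iff.mpr ⟨2 * k * K + 1, by positivity, fun n x z hz => ?_⟩,
    isOperatorSystem_iff.mpr ⟨K + 1, by positivity, hG.isNormal_dual hK⟩⟩
  refine (hG.isNormal hk hM n x z hz).trans ?_
  have := matNorm_nonneg _ z
  gcongr
  linarith

end Transfer

/-! ### Duality between M_n(V^*) and M_n(V). -/

section Pairing

variable {V : Type*} [NormedAddCommGroup V] [NormedSpace ℂ V]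

/-- The duality between `M_n(V^*)` and `M_n(V)`. -/
def pair {n : ℕ} (F : Matrix (Fin n) (Fin n) (OpDual V)) (x : Matrix (Fin n) (Fin n) V) : ℂ :=
  ∑ i, ∑ j, F i j (x i j)

theorem pair_add {n : ℕ} (F : Matrix (Fin n) (Fin n) (OpDual V)) (x y : Matrix (Fin n) (Fin n) V) :
    pair F (x + y) = pair F x + pair F y := by
  simp [pair, OpDual.map_add, Finset.sum_add_distrib]

theorem pair_smul {n : ℕ} (F : Matrix (Fin n) (Fin n) (OpDual V)) (c : ℂ)
    (x : Matrix (Fin n) (Fin n) V) : pair F (c • x) = c * pair F x := by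
  simp [pair, OpDual.map_smul, Finset.mul_sum]

theorem pair_zero {n : ℕ} (F : Matrix (Fin n) (Fin n) (OpDual V)) : pair F 0 = 0 := by
  simp [pair, OpDual.map_zero]

/-- The entries of a matrix as a vector. -/
def toVec {m n : ℕ} (γ : Matrix (Fin m) (Fin n) ℂ) : Fin m × Fin n → ℂ := fun p => γ p.1 p.2

/-- The bridge between a functional on M_n(V) and the amplifications of the map V → M_n with the
same entries. Positivity and norm bounds are carried across it. -/
theorem pair_scalarMul {m n : ℕ} (F : Matrix (Fin n) (Fin n) (OpDual V))
    (γ' γ : Matrix (Fin m) (Fin n) ℂ) (x : Matrix (Fin m) (Fin m) V) :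
    pair F (scalarMul γ'.conjTranspose x γ) = star (toVec γ') ⬝ᵥ (amp F x).mulVec (toVec γ) := by
  simp only [pair, scalarMul, dotProduct, Matrix.mulVec, Fintype.sum_prod_type, toVec, amp,
    Matrix.of_apply, OpDual.map_sum, OpDual.map_smul, Matrix.conjTranspose_apply, Pi.star_apply,
    Finset.mul_sum]
  calc _ = ∑ i, ∑ p, ∑ j, ∑ q, star (γ' p i) * γ q j * F i j (x p q) :=
        Finset.sum_congr rfl fun i _ => Finset.sum_comm
    _ = ∑ p, ∑ i, ∑ q, ∑ j, star (γ' p i) * γ q j * F i j (x p q) := by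
        rw [Finset.sum_comm]
        exact Finset.sum_congr rfl fun p _ => Finset.sum_congr rfl fun i _ => Finset.sum_comm
    _ = _ := by
        refine Finset.sum_congr rfl fun p _ => Finset.sum_congr rfl fun i _ =>
          Finset.sum_congr rfl fun q _ => Finset.sum_congr rfl fun j _ => ?_
        ring

theorem pair_scalarMul_left {k n : ℕ} (α : Matrix (Fin k) (Fin n) ℂ)
    (F : Matrix (Fin n) (Fin n) (OpDual V)) (β : Matrix (Fin n) (Fin k) ℂ)
    (x : Matrix (Fin k) (Fin k) V) :
    pair (scalarMul α F β) x = pair F (scalarMul α.transpose x β.transpose) := by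
  simp only [pair, scalarMul, Matrix.of_apply, OpDual.sum_apply, OpDual.smul_apply,
    OpDual.map_sum, OpDual.map_smul, Matrix.transpose_apply]
  calc _ = ∑ i, ∑ p, ∑ j, ∑ q, α i p * β q j * F p q (x i j) :=
        Finset.sum_congr rfl fun i _ => Finset.sum_comm
    _ = ∑ p, ∑ i, ∑ q, ∑ j, α i p * β q j * F p q (x i j) := by
        rw [Finset.sum_comm]
        exact Finset.sum_congr rfl fun p _ => Finset.sum_congr rfl fun i _ => Finset.sum_comm
    _ = _ := Finset.sum_congr rfl fun p _ => Finset.sum_comm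

end Pairing

/-! ### Stacked columns and density matrices. -/

section Stack

/-- Two matrices on top of each other. -/
def stack {m m' n : ℕ} (γ : Matrix (Fin m) (Fin n) ℂ) (δ : Matrix (Fin m') (Fin n) ℂ) :
    Matrix (Fin (m + m')) (Fin n) ℂ :=
  Matrix.of fun i j => Fin.addCases (fun p => γ p j) (fun p => δ p j) i

theorem conjTranspose_stack_mul {m m' n : ℕ} (γ : Matrix (Fin m) (Fin n) ℂ)
    (δ : Matrix (Fin m') (Fin n) ℂ) :
    (stack γ δ).conjTranspose * stack γ δ = γ.conjTranspose * γ + δ.conjTranspose * δ := by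
  ext i j
  simp [stack, Matrix.mul_apply, Fin.sum_univ_add]

theorem scalarMul_stack_block {V : Type*} [AddCommGroup V] [Module ℂ V] {m m' n : ℕ}
    (γ γ' : Matrix (Fin m) (Fin n) ℂ) (δ δ' : Matrix (Fin m') (Fin n) ℂ)
    (x : Matrix (Fin m) (Fin m) V) (y : Matrix (Fin m') (Fin m') V) :
    scalarMul (stack γ' δ').conjTranspose (block x 0 0 y) (stack γ δ)
      = scalarMul γ'.conjTranspose x γ + scalarMul δ'.conjTranspose y δ := by
  ext i j
  simp [stack, scalarMul, Fin.sum_univ_add]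

/-- Each factor has square at most the right side, since the other summand is positive. -/
theorem norm_mul_norm_le {m n : ℕ} (γ γ' : Matrix (Fin m) (Fin n) ℂ) :
    ‖γ'‖ * ‖γ‖ ≤ ‖γ.conjTranspose * γ + γ'.conjTranspose * γ'‖ := by
  set c := ‖γ.conjTranspose * γ + γ'.conjTranspose * γ'‖ with hc
  have key : ∀ δ δ' : Matrix (Fin m) (Fin n) ℂ,
      ‖δ.conjTranspose * δ + δ'.conjTranspose * δ'‖ = c → ‖δ‖ ≤ √c := fun δ δ' h => by
    refine l2_norm_le (Real.sqrt_nonneg _) fun ξ => ?_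
    rw [Real.sq_sqrt (norm_nonneg _)]
    refine le_trans ?_ (re_quadratic_le _ ξ h.le)
    have e : ∀ ε : Matrix (Fin m) (Fin n) ℂ, star ξ ⬝ᵥ (ε.conjTranspose * ε).mulVec ξ
        = ((∑ i, ‖ε.mulVec ξ i‖ ^ 2 : ℝ) : ℂ) := fun ε => by
      rw [← dotProduct_star_self_eq, Matrix.star_mulVec, ← Matrix.mulVec_mulVec,
        Matrix.dotProduct_mulVec]
    rw [Matrix.add_mulVec, dotProduct_add, e, e, ← Complex.ofReal_add, Complex.ofReal_re]
    have : 0 ≤ ∑ i, ‖δ'.mulVec ξ i‖ ^ 2 := by positivity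
    linarith
  calc ‖γ'‖ * ‖γ‖ ≤ √c * √c := mul_le_mul (key γ' γ (by rw [add_comm])) (key γ γ' rfl)
        (norm_nonneg _) (Real.sqrt_nonneg _)
    _ = c := Real.mul_self_sqrt (norm_nonneg _)

end Stack

open scoped MatrixOrder in
theorem exists_invertible_factor {n : ℕ} {ρ : Matrix (Fin n) (Fin n) ℂ} (hρ : ρ.PosSemidef)
    (htr : ρ.trace.re ≤ 1) :
    ∃ B : Matrix (Fin n) (Fin n) ℂ, IsUnit B.det ∧ ∑ i, ∑ j, ‖B i j‖ ^ 2 ≤ 2 ∧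
      (B.conjTranspose * B - ρ).PosSemidef := by
  -- Adding t to ρ makes it invertible and raises the trace by n t ≤ 1, whence the bound 2.
  let t : ℝ := 1 / (n + 1)
  have ht : 0 < t := by positivity
  have htn : n * t ≤ 1 := by
    rw [mul_one_div, div_le_one (by positivity)]
    linarith
  have hpos : ((t : ℂ) • (1 : Matrix (Fin n) (Fin n) ℂ)).PosDef :=
    Matrix.PosDef.one.smul (by exact_mod_cast ht)
  have hsum := Matrix.PosDef.posSemidef_add hρ hpos
  obtain ⟨B, hB⟩ := CStarAlgebra.nonneg_iff_eq_star_mul_self.mp hsum.posSemidef.nonneg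
  rw [Matrix.star_eq_conjTranspose] at hB
  refine ⟨B, ?_, ?_, ?_⟩
  · have := (Matrix.isUnit_iff_isUnit_det _).mp hsum.isUnit
    rw [hB, Matrix.det_mul] at this
    exact isUnit_of_mul_isUnit_right this
  · have h1 := congrArg (fun A => (Matrix.trace A).re) hB
    have h2 : (B.conjTranspose * B).trace = ((∑ i, ∑ j, ‖B i j‖ ^ 2 : ℝ) : ℂ) := by
      rw [Finset.sum_comm]
      push_cast
      simp only [Matrix.trace, Matrix.diag, Matrix.mul_apply, Matrix.conjTranspose_apply]
      exact Finset.sum_congr rfl fun i _ => Finset.sum_congr rfl fun j _ =>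
        Complex.conj_mul' (B j i)
    have h3 : ((t : ℂ) • (1 : Matrix (Fin n) (Fin n) ℂ)).trace = ((n * t : ℝ) : ℂ) := by
      rw [Matrix.trace_smul, Matrix.trace_one, Fintype.card_fin, smul_eq_mul]
      push_cast
      ring
    simp only [h2, Matrix.trace_add, h3, Complex.add_re, Complex.ofReal_re] at h1
    linarith
  · rw [← hB, add_sub_cancel_left]
    exact hpos.posSemidef

section Scaling

variable {V : Type*} [NormedAddCommGroup V] [NormedSpace ℂ V] [OperatorSpace V]

/-- The pairs (γ^*γ + γ'^*γ', Re F(γ'^* x γ)) with ‖x‖ ≤ 1 form a convex cone dominated by the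
operator norm. A linear functional in between is A ↦ tr(ρA) on selfadjoint A. -/
theorem exists_density {n : ℕ} (F : Matrix (Fin n) (Fin n) (OpDual V))
    (hF : ∀ x, ‖pair F x‖ ≤ matNorm n x) :
    ∃ ρ : Matrix (Fin n) (Fin n) ℂ, ρ.PosSemidef ∧ ρ.trace.re ≤ 1 ∧
      ∀ (m : ℕ) (γ γ' : Matrix (Fin m) (Fin n) ℂ) (x : Matrix (Fin m) (Fin m) V),
        matNorm m x ≤ 1 → (pair F (scalarMul γ'.conjTranspose x γ)).re
          ≤ (ρ * (γ.conjTranspose * γ + γ'.conjTranspose * γ')).trace.re := by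
  obtain ⟨g, hg, hgR⟩ := exists_linear_between (E := Matrix (Fin n) (Fin n) ℂ) (fun A => ‖A‖)
    (fun c hc A => by rw [norm_smul, Real.norm_of_nonneg hc.le]) norm_add_le
    {e | ∃ (m : ℕ) (γ γ' : Matrix (Fin m) (Fin n) ℂ) (x : Matrix (Fin m) (Fin m) V),
      matNorm m x ≤ 1 ∧ e = (γ.conjTranspose * γ + γ'.conjTranspose * γ',
        (pair F (scalarMul γ'.conjTranspose x γ)).re)}
    ⟨0, 0, 0, 0, by simp [matNorm_zero], by simp [scalarMul_zero, pair_zero, Prod.zero_eq_mk]⟩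
    (by
      rintro _ ⟨m, γ, γ', x, hx, rfl⟩ _ ⟨m', δ, δ', y, hy, rfl⟩
      -- Direct sums of x and y have norm at most one, so stacking closes the cone under addition.
      refine ⟨m + m', stack γ δ, stack γ' δ', block x 0 0 y, ?_, ?_⟩
      · rw [matNorm_directSum]
        exact max_le hx hy
      · rw [scalarMul_stack_block, conjTranspose_stack_mul, conjTranspose_stack_mul, pair_add,
          Complex.add_re, Prod.mk_add_mk]
        congr 1
        abel)
    (by
      rintro c hc _ ⟨m, γ, γ', x, hx, rfl⟩
      have e : ((√c : ℝ) : ℂ) * ((√c : ℝ) : ℂ) = (c : ℂ) := by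
        rw [← Complex.ofReal_mul, Real.mul_self_sqrt hc.le]
      refine ⟨m, ((√c : ℝ) : ℂ) • γ, ((√c : ℝ) : ℂ) • γ', x, hx, ?_⟩
      simp only [Matrix.conjTranspose_smul, Complex.star_def, Complex.conj_ofReal, smul_scalarMul,
        scalarMul_smul_right, Matrix.smul_mul, Matrix.mul_smul, smul_smul, e, pair_smul,
        Complex.re_ofReal_mul, Prod.smul_mk, smul_add, smul_eq_mul]
      simp only [Complex.coe_smul])
    (by
      rintro _ ⟨m, γ, γ', x, hx, rfl⟩
      refine (Complex.re_le_norm _).trans ((hF _).trans ((matNorm_scalarMul_le _ _ _ _ _).trans ?_))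
      rw [Matrix.l2_opNorm_conjTranspose]
      refine le_trans ?_ (norm_mul_norm_le γ γ')
      gcongr
      exact mul_le_of_le_one_right (norm_nonneg _) hx)
  obtain ⟨φ, hφ, hre⟩ := exists_selfAdjoint_functional g
  have hsa : ∀ A : Matrix (Fin n) (Fin n) ℂ, star A = A → φ A = (g A : ℂ) := fun x hx => by
    have h1 := hφ x
    rw [hx] at h1
    have h2 := hre x
    rw [hx] at h2
    rw [← Complex.conj_eq_iff_re.mp h1.symm, h2]
    push_cast
    ring
  let ρ : Matrix (Fin n) (Fin n) ℂ := Matrix.of fun i j => φ (Matrix.single j i 1)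
  have htr : ∀ A : Matrix (Fin n) (Fin n) ℂ, (ρ * A).trace = φ A := fun A => by
    conv_rhs => rw [Matrix.matrix_eq_sum_single A]
    simp only [map_sum, Matrix.trace, Matrix.diag, Matrix.mul_apply]
    rw [Finset.sum_comm]
    refine Finset.sum_congr rfl fun i _ => Finset.sum_congr rfl fun j _ => ?_
    have : Matrix.single i j (A i j) = A i j • Matrix.single i j (1 : ℂ) := by
      rw [Matrix.smul_single, smul_eq_mul, mul_one]
    rw [this, map_smul, smul_eq_mul, mul_comm]
    rfl
  have hH : ∀ {m : ℕ} (γ : Matrix (Fin m) (Fin n) ℂ),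
      star (γ.conjTranspose * γ) = γ.conjTranspose * γ := fun γ => by
    rw [Matrix.star_eq_conjTranspose, Matrix.conjTranspose_mul, Matrix.conjTranspose_conjTranspose]
  refine ⟨ρ, ?_, ?_, ?_⟩
  · rw [Matrix.posSemidef_iff_dotProduct_mulVec]
    refine ⟨?_, fun u => ?_⟩
    · ext i j
      have := hφ (Matrix.single i j 1)
      rw [Matrix.star_eq_conjTranspose, Matrix.conjTranspose_single, star_one] at this
      exact this.symm
    · let γ : Matrix (Fin 1) (Fin n) ℂ := Matrix.of fun _ j => star (u j)
      have e : star u ⬝ᵥ ρ.mulVec u = (ρ * (γ.conjTranspose * γ)).trace := by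
        simp only [dotProduct, Matrix.mulVec, Matrix.trace, Matrix.diag, Matrix.mul_apply,
          Finset.mul_sum, γ, Matrix.conjTranspose_apply, Matrix.of_apply, star_star,
          Finset.univ_unique, Finset.sum_singleton, Pi.star_apply]
        refine Finset.sum_congr rfl fun i _ => Finset.sum_congr rfl fun j _ => ?_
        ring
      rw [e, htr, hsa _ (hH γ)]
      -- With x = 0 the cone contains (γ^*γ, 0), which makes the functional, hence ρ, positive.
      have := hgR (γ.conjTranspose * γ, 0) ⟨1, γ, 0, 0, by simp [matNorm_zero], by
        simp [scalarMul_zero, pair_zero]⟩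
      exact_mod_cast this
  · have h1 := htr 1
    rw [mul_one] at h1
    rw [h1, hsa 1 (star_one _), Complex.ofReal_re]
    refine (hg 1).trans (norm_le_one_of_isometry 1 ?_)
    simp
  · intro m γ γ' x hx
    rw [htr, hsa _ (by rw [star_add, hH, hH]), Complex.ofReal_re]
    exact hgR _ ⟨m, γ, γ', x, hx, rfl⟩

/-- A functional of norm at most one on `M_n(V)` is a matrix of functionals with bounded `cb`-norm,
up to scaling by Hilbert–Schmidt matrices. -/
theorem exists_scaling {n : ℕ} (F : Matrix (Fin n) (Fin n) (OpDual V))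
    (hF : ∀ x, ‖pair F x‖ ≤ matNorm n x) :
    ∃ σ τ : Matrix (Fin n) (Fin n) ℂ, σ * τ = 1 ∧ ∑ i, ∑ j, ‖τ i j‖ ^ 2 ≤ 2 ∧
      cbNorm n (scalarMul σ.conjTranspose F σ) ≤ 2 := by
  obtain ⟨ρ, hρ, htr, hle⟩ := exists_density F hF
  obtain ⟨B, hB, hB2, hBρ⟩ := exists_invertible_factor hρ htr
  have hBu : IsUnit B.conjTranspose.det := by
    rw [Matrix.det_conjTranspose]
    exact hB.star
  -- The transpose appears because α F β pairs with x as F does with α^T x β^T. The matrix σ^T is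
  -- chosen to cancel B^* in the trace estimate.
  let σ : Matrix (Fin n) (Fin n) ℂ := (B.conjTranspose)⁻¹.transpose
  have hσB : σ.transpose * B.conjTranspose = 1 := Matrix.nonsing_inv_mul _ hBu
  refine ⟨σ, B.conjTranspose.transpose, ?_, ?_, ?_⟩
  · rw [← Matrix.transpose_mul, Matrix.mul_nonsing_inv _ hBu, Matrix.transpose_one]
  · simpa using hB2
  · refine Real.sSup_le ?_ two_pos.le
    rintro _ ⟨m, x, hx, rfl⟩
    refine l2_norm_le_of_re_le two_pos.le fun ξ η => ?_
    let γ' : Matrix (Fin m) (Fin n) ℂ := Matrix.of fun i j => ξ (i, j)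
    let γ : Matrix (Fin m) (Fin n) ℂ := Matrix.of fun i j => η (i, j)
    have e : star ξ ⬝ᵥ (amp (scalarMul σ.conjTranspose F σ) x).mulVec η
        = pair F (scalarMul (γ' * σ.transpose).conjTranspose x (γ * σ.transpose)) := by
      have h1 := pair_scalarMul (scalarMul σ.conjTranspose F σ) γ' γ x
      rw [pair_scalarMul_left, scalarMul_scalarMul] at h1
      rw [Matrix.conjTranspose_mul]
      exact h1.symm
    have htrace : ∀ δ : Matrix (Fin m) (Fin n) ℂ,
        (ρ * ((δ * σ.transpose).conjTranspose * (δ * σ.transpose))).trace.re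
          ≤ ∑ p : Fin m × Fin n, ‖δ p.1 p.2‖ ^ 2 := fun δ => by
      obtain ⟨ε, hε⟩ : ∃ ε, ε = δ * σ.transpose := ⟨_, rfl⟩
      rw [← hε]
      -- Since ρ ≤ B^*B, tr(ρ ε^*ε) is at most tr(B^*B ε^*ε), the squared Hilbert–Schmidt norm of
      -- εB^* = δ.
      have h1 : 0 ≤ ((B.conjTranspose * B - ρ) * (ε.conjTranspose * ε)).trace := by
        rw [← Matrix.mul_assoc, Matrix.trace_mul_comm, ← Matrix.mul_assoc]
        exact (hBρ.mul_mul_conjTranspose_same ε).trace_nonneg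
      rw [Matrix.sub_mul, Matrix.trace_sub, Complex.le_def] at h1
      have h2 := h1.1
      have h3 : (B.conjTranspose * B * (ε.conjTranspose * ε)).trace
          = ((∑ p : Fin m × Fin n, ‖δ p.1 p.2‖ ^ 2 : ℝ) : ℂ) := by
        have hδ : ε * B.conjTranspose = δ := by rw [hε, Matrix.mul_assoc, hσB, Matrix.mul_one]
        have : (B.conjTranspose * B * (ε.conjTranspose * ε)).trace
            = (δ * δ.conjTranspose).trace := by
          rw [← hδ, Matrix.conjTranspose_mul, Matrix.conjTranspose_conjTranspose,
            ← Matrix.mul_assoc, Matrix.trace_mul_comm]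
          simp only [Matrix.mul_assoc]
        rw [this, Fintype.sum_prod_type]
        push_cast
        simp only [Matrix.trace, Matrix.diag, Matrix.mul_apply, Matrix.conjTranspose_apply]
        exact Finset.sum_congr rfl fun i _ => Finset.sum_congr rfl fun j _ =>
          Complex.mul_conj' (δ i j)
      rw [h3, Complex.sub_re, Complex.ofReal_re, Complex.zero_re] at h2
      linarith
    have h1 := hle m (γ * σ.transpose) (γ' * σ.transpose) x hx
    rw [← e, Matrix.mul_add, Matrix.trace_add, Complex.add_re] at h1
    have h2 := htrace γ
    have h3 := htrace γ'
    have h4 : (∑ p : Fin m × Fin n, ‖γ p.1 p.2‖ ^ 2) = ∑ p, ‖η p‖ ^ 2 := rfl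
    have h5 : (∑ p : Fin m × Fin n, ‖γ' p.1 p.2‖ ^ 2) = ∑ p, ‖ξ p‖ ^ 2 := rfl
    linarith

end Scaling

/-! ### Functionals on M_n(V) as matrices over V^*. -/

section Functionals

variable {V : Type*} [NormedAddCommGroup V] [NormedSpace ℂ V]

theorem pair_single {n : ℕ} (F : Matrix (Fin n) (Fin n) (OpDual V)) (i j : Fin n) (v : V) :
    pair F (Matrix.single i j v) = F i j v := by
  rw [pair, Finset.sum_eq_single i, Finset.sum_eq_single j]
  · simp
  · intro q _ hq
    rw [Matrix.single_apply_of_col_ne _ _ hq.symm, OpDual.map_zero]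
  · simp
  · intro p _ hp
    refine Finset.sum_eq_zero fun q _ => ?_
    rw [Matrix.single_apply_of_row_ne hp.symm, OpDual.map_zero]
  · simp

theorem pair_block {m n : ℕ} (A : Matrix (Fin m) (Fin m) (OpDual V))
    (D : Matrix (Fin n) (Fin n) (OpDual V)) (B : Matrix (Fin m) (Fin n) (OpDual V))
    (C : Matrix (Fin n) (Fin m) (OpDual V)) (a : Matrix (Fin m) (Fin m) V)
    (b : Matrix (Fin m) (Fin n) V) (c : Matrix (Fin n) (Fin m) V) (d : Matrix (Fin n) (Fin n) V) :
    pair (block A B C D) (block a b c d) = (∑ i, ∑ j, A i j (a i j) + ∑ i, ∑ j, B i j (b i j))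
      + (∑ i, ∑ j, C i j (c i j) + ∑ i, ∑ j, D i j (d i j)) := by
  simp [pair, Fin.sum_univ_add, Finset.sum_add_distrib, -Fin.natAdd_eq_addNat]
  ring

theorem matNorm_single_le [OperatorSpace V] {n : ℕ} (i j : Fin n) (v : V) :
    matNorm n (Matrix.single i j v) ≤ ‖v‖ := by
  refine (matNorm_le_sum_norm _).trans (le_of_eq ?_)
  rw [Finset.sum_eq_single i, Finset.sum_eq_single j]
  · simp
  · intro q _ hq
    rw [Matrix.single_apply_of_col_ne _ _ hq.symm, norm_zero]
  · simp
  · intro p _ hp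
    refine Finset.sum_eq_zero fun q _ => ?_
    rw [Matrix.single_apply_of_row_ne hp.symm, norm_zero]
  · simp

theorem exists_pair_eq [OperatorSpace V] {n : ℕ} (φ : Matrix (Fin n) (Fin n) V →ₗ[ℂ] ℂ) {c : ℝ}
    (hc : 0 ≤ c) (hφ : ∀ x, ‖φ x‖ ≤ c * matNorm n x) :
    ∃ F : Matrix (Fin n) (Fin n) (OpDual V), ∀ x, pair F x = φ x := by
  let F : Matrix (Fin n) (Fin n) (OpDual V) := Matrix.of fun i j =>
    LinearMap.mkContinuous (𝕜 := ℂ) (𝕜₂ := ℂ) (E := V) (F := ℂ) (σ := RingHom.id ℂ)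
      (φ ∘ₗ Matrix.singleLinearMap ℂ i j) c fun v =>
        (hφ _).trans (mul_le_mul_of_nonneg_left (matNorm_single_le i j v) hc)
  refine ⟨F, fun x => ?_⟩
  conv_rhs => rw [Matrix.matrix_eq_sum_single x]
  simp only [map_sum]
  rfl

/-- By `pair_scalarMul` the quadratic form of the m-th amplification at x is the functional at γ^* x
γ. So positivity on M_n(V)^+ alone yields complete positivity. -/
theorem mem_dualCone_of_pair [StarAddMonoid V] [StarModule ℂ V] [MatrixOrderedOperatorSpace V]
    {n : ℕ} {F : Matrix (Fin n) (Fin n) (OpDual V)}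
    (h_star : ∀ x, pair F x.conjTranspose = star (pair F x)) (h_pos : ∀ x ∈ cone n, 0 ≤ pair F x) :
    F ∈ dualCone V n := by
  have hF : F.IsHermitian := by
    ext i j
    refine OpDual.ext fun v => ?_
    rw [Matrix.conjTranspose_apply, OpDual.star_apply, ← pair_single, ← pair_single, ← h_star,
      Matrix.conjTranspose_single, star_star]
  refine ⟨hF, fun m x hx => ?_⟩
  rw [Matrix.posSemidef_iff_dotProduct_mulVec]
  refine ⟨?_, fun ξ => ?_⟩
  · have := amp_conjTranspose F x
    rw [hF.eq, (isHermitian_of_mem_cone m x hx).eq] at this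
    exact this.symm
  · have := pair_scalarMul F (Matrix.of fun i j => ξ (i, j)) (Matrix.of fun i j => ξ (i, j)) x
    have h2 := h_pos _ (scalarMul_mem_cone m n (Matrix.of fun i j => ξ (i, j)) x hx)
    rw [this] at h2
    exact h2

end Functionals

/-! ### Normality of the dual makes the cones generating. -/

section Generation

variable {V : Type*} [NormedAddCommGroup V] [NormedSpace ℂ V] [StarAddMonoid V]
  [StarModule ℂ V] [MatrixOrderedOperatorSpace V]

/-- A positive functional on `M_2n(V)` whose diagonal is contractive has a bounded off-diagonal,
provided that the dual is normal. -/
theorem IsNormal.norm_pair_offDiag_le {k : ℝ} (hk : 0 ≤ k) (h : IsNormal (OpDual V) k) {n : ℕ}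
    {A B C D : Matrix (Fin n) (Fin n) (OpDual V)} (hpos : block A B C D ∈ dualCone V (n + n))
    (hA : ∀ x, ‖pair A x‖ ≤ matNorm n x) (hD : ∀ x, ‖pair D x‖ ≤ matNorm n x)
    (x : Matrix (Fin n) (Fin n) V) : ‖pair B x‖ ≤ 4 * k * matNorm n x := by
  obtain ⟨σ₁, τ₁, h1, hτ₁, hσ₁⟩ := exists_scaling A hA
  obtain ⟨σ₂, τ₂, h2, hτ₂, hσ₂⟩ := exists_scaling D hD
  -- Congruence by σ₁ ⊕ σ₂ keeps positivity and brings the diagonal to cb-norm at most 2, so that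
  -- normality of the dual bounds the corner H.
  have h3 := block_dsum_mem_cone (V := OpDual V) σ₁.conjTranspose σ₂.conjTranspose hpos
  simp only [Matrix.conjTranspose_conjTranspose] at h3
  set H := scalarMul σ₁.conjTranspose B σ₂ with hH
  have hC : scalarMul σ₂.conjTranspose C σ₁ = H.conjTranspose := by
    have := hpos.1
    rw [Matrix.IsHermitian, block_conjTranspose] at this
    have hBC : B.conjTranspose = C := by
      ext i j : 2
      have := congrFun (congrFun this (Fin.natAdd n i)) (Fin.castAdd n j)
      rwa [block_right_left, block_right_left] at this
    rw [hH, conjTranspose_scalarMul, hBC, Matrix.conjTranspose_conjTranspose]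
  have h4 := h n H (block (scalarMul σ₁.conjTranspose A σ₁) 0 0 (scalarMul σ₂.conjTranspose D σ₂)) (by
    rw [hC] at h3
    convert block_neg_mem_cone h3 using 1
    rw [block_sub]
    congr 1 <;> simp)
  have h5 : matNorm n H ≤ 2 * k := by
    refine h4.trans ?_
    rw [matNorm_directSum, mul_comm]
    exact mul_le_mul_of_nonneg_right (max_le hσ₁ hσ₂) hk
  -- Undoing the scaling evaluates H on two vectors of length at most √2, so the bound 2k for H
  -- becomes 4k.
  have hB : B = scalarMul τ₁.conjTranspose H τ₂ := by
    rw [hH, scalarMul_scalarMul, ← Matrix.conjTranspose_mul, h1, h2, Matrix.conjTranspose_one,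
      one_scalarMul_one]
  have hB' : pair B x = star (toVec τ₁.transpose) ⬝ᵥ (amp H x).mulVec (toVec τ₂.transpose) := by
    conv_lhs => rw [hB]
    rw [pair_scalarMul_left]
    exact pair_scalarMul H τ₁.transpose τ₂.transpose x
  have hvec : ∀ τ : Matrix (Fin n) (Fin n) ℂ, ∑ i, ∑ j, ‖τ i j‖ ^ 2 ≤ 2 →
      √(∑ p, ‖toVec τ.transpose p‖ ^ 2) ≤ √2 := fun τ hτ => by
    refine Real.sqrt_le_sqrt (le_trans (le_of_eq ?_) hτ)
    rw [Fintype.sum_prod_type, Finset.sum_comm]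
    rfl
  have hamp : ‖amp H x‖ ≤ 2 * k * matNorm n x := (cbBound_cbNorm H n x).trans
    (mul_le_mul_of_nonneg_right h5 (matNorm_nonneg n x))
  rw [hB']
  have hx := matNorm_nonneg n x
  calc _ ≤ ‖amp H x‖ * (√(∑ p, ‖toVec τ₁.transpose p‖ ^ 2) * √(∑ p, ‖toVec τ₂.transpose p‖ ^ 2)) :=
        norm_sesquilinear_le _ _ _
    _ ≤ 2 * k * matNorm n x * (√2 * √2) := mul_le_mul hamp
        (mul_le_mul (hvec τ₁ hτ₁) (hvec τ₂ hτ₂) (Real.sqrt_nonneg _) (Real.sqrt_nonneg _))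
        (by positivity) (by positivity)
    _ = _ := by
        rw [Real.mul_self_sqrt two_pos.le]
        ring

/-- The seminorm `‖a‖ + ‖d‖ + L (‖b‖ + ‖c‖)` of a block matrix `(a b; c d)`. -/
def blockSeminorm (V : Type*) [NormedAddCommGroup V] [NormedSpace ℂ V] [OperatorSpace V] (n : ℕ)
    {L : ℝ} (hL : 0 ≤ L) : Seminorm ℂ (Matrix (Fin (n + n)) (Fin (n + n)) V) :=
  Seminorm.of (fun w => matNorm n (w.submatrix (Fin.castAdd n) (Fin.castAdd n))
      + matNorm n (w.submatrix (Fin.natAdd n) (Fin.natAdd n))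
      + L * (matNorm n (w.submatrix (Fin.castAdd n) (Fin.natAdd n))
        + matNorm n (w.submatrix (Fin.natAdd n) (Fin.castAdd n))))
    (fun w z => by
      have h : ∀ f g : Fin n → Fin (n + n), matNorm n ((w + z).submatrix f g)
          ≤ matNorm n (w.submatrix f g) + matNorm n (z.submatrix f g) := fun f g =>
        matNorm_add_le n _ _
      have h1 := h (Fin.castAdd n) (Fin.castAdd n)
      have h2 := h (Fin.natAdd n) (Fin.natAdd n)
      have h3 := mul_le_mul_of_nonneg_left
        (add_le_add (h (Fin.castAdd n) (Fin.natAdd n)) (h (Fin.natAdd n) (Fin.castAdd n))) hL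
      linarith)
    (fun c w => by
      have h : ∀ f g : Fin n → Fin (n + n), matNorm n ((c • w).submatrix f g)
          = ‖c‖ * matNorm n (w.submatrix f g) := fun f g => matNorm_smul n c _
      rw [h, h, h, h]
      ring)

theorem blockSeminorm_block {L : ℝ} (hL : 0 ≤ L) {n : ℕ} (a b c d : Matrix (Fin n) (Fin n) V) :
    blockSeminorm V n hL (block a b c d)
      = matNorm n a + matNorm n d + L * (matNorm n b + matNorm n c) := by
  have h : ∀ w, blockSeminorm V n hL w = matNorm n (w.submatrix (Fin.castAdd n) (Fin.castAdd n))
      + matNorm n (w.submatrix (Fin.natAdd n) (Fin.natAdd n))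
      + L * (matNorm n (w.submatrix (Fin.castAdd n) (Fin.natAdd n))
        + matNorm n (w.submatrix (Fin.natAdd n) (Fin.castAdd n))) := fun w => rfl
  rw [h]
  congr 2
  · congr 1
    ext; simp
  · congr 1
    ext; simp [-Fin.natAdd_eq_addNat]
  · congr 2 <;> ext <;> simp [-Fin.natAdd_eq_addNat]

theorem IsNormal.exists_approx {k : ℝ} (hk : 0 ≤ k) (h : IsNormal (OpDual V) k) {n : ℕ}
    (x : Matrix (Fin n) (Fin n) V) : ∃ a b y : Matrix (Fin n) (Fin n) V,
      block a y y.conjTranspose b ∈ cone (n + n) ∧ matNorm n a ≤ (8 * k + 1) * matNorm n x ∧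
        matNorm n b ≤ (8 * k + 1) * matNorm n x ∧ matNorm n (x - y) ≤ 1 / 2 * matNorm n x := by
  -- The two corners of a separating functional contribute at most 4k‖x‖ each; K must exceed 8k.
  set K := 8 * k + 1 with hK
  have hK0 : 0 < K := by positivity
  rcases (matNorm_nonneg n x).eq_or_lt with h0 | h0
  · have := eq_zero_of_matNorm n x h0.symm
    subst this
    exact ⟨0, 0, 0, by simpa [block_zero] using zero_mem_cone (n + n), by simp [matNorm_zero]⟩
  -- Weight 1 makes the diagonal of the functional contractive, while weight K penalises the
  -- distance from x to the corner.
  set p := blockSeminorm V n hK0.le with hp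
  set v := block 0 x x.conjTranspose 0 with hv
  obtain ⟨c, hc, hlt⟩ : ∃ c ∈ cone (n + n), p (v + c) < K * matNorm n x := by
    by_contra! hcon
    obtain ⟨φ, hφ1, hφ2, hφ3, hφ4⟩ := exists_positive_functional p
      (fun w => by
        obtain ⟨a, b, c, d, rfl⟩ : ∃ a b c d, w = block a b c d := ⟨_, _, _, _, eq_block w⟩
        rw [Matrix.star_eq_conjTranspose, block_conjTranspose, hp, blockSeminorm_block,
          blockSeminorm_block]
        simp only [matNorm_conjTranspose]
        ring)
      (cone (n + n)) (zero_mem_cone _) (fun x hx y hy => add_mem_cone _ x y hx hy)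
      (fun c hc x hx => smul_mem_cone _ c x hc.le hx) (fun x hx => isHermitian_of_mem_cone _ x hx)
      (block_offDiag_isHermitian x) hcon
    obtain ⟨F, hF⟩ := exists_pair_eq φ (c := 2 + 2 * K) (by positivity) (fun w => by
      refine (hφ3 w).trans ?_
      obtain ⟨a, b, c, d, rfl⟩ : ∃ a b c d, w = block a b c d := ⟨_, _, _, _, eq_block w⟩
      rw [hp, blockSeminorm_block]
      have h1 := matNorm_upperLeft_le a b c d
      have h2 := matNorm_upperRight_le a b c d
      have h4 := matNorm_lowerRight_le a b c d
      have h3 : matNorm n c ≤ matNorm (n + n) (block a b c d) := by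
        have := matNorm_upperRight_le a.conjTranspose c.conjTranspose b.conjTranspose
          d.conjTranspose
        rwa [← block_conjTranspose, matNorm_conjTranspose, matNorm_conjTranspose] at this
      have h5 := mul_le_mul_of_nonneg_left (add_le_add h2 h3) hK0.le
      linarith)
    obtain ⟨A, B, C, D, rfl⟩ : ∃ A B C D, F = block A B C D := ⟨_, _, _, _, eq_block F⟩
    have hpos : block A B C D ∈ dualCone V (n + n) := by
      refine mem_dualCone_of_pair (fun x => ?_) (fun x hx => ?_)
      · rw [hF, hF]
        exact hφ1 x
      · rw [hF]
        exact hφ2 x hx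
    have hA : ∀ a, ‖pair A a‖ ≤ matNorm n a := fun a => by
      have h1 := hφ3 (block a 0 0 0)
      rw [← hF, pair_block, hp, blockSeminorm_block] at h1
      simpa [OpDual.map_zero, matNorm_zero, pair] using h1
    have hD : ∀ d, ‖pair D d‖ ≤ matNorm n d := fun d => by
      have h1 := hφ3 (block 0 0 0 d)
      rw [← hF, pair_block, hp, blockSeminorm_block] at h1
      simpa [OpDual.map_zero, matNorm_zero, pair] using h1
    have hB := h.norm_pair_offDiag_le hk hpos hA hD x
    have hB' : φ (block 0 x 0 0) = pair B x := by
      rw [← hF, pair_block]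
      simp [OpDual.map_zero, pair]
    have hval : φ v = pair B x + star (pair B x) := by
      rw [← hB', ← hφ1, ← map_add, Matrix.star_eq_conjTranspose, block_conjTranspose, block_add, hv]
      simp
    rw [← hv, hval] at hφ4
    have h6 := norm_add_le (pair B x) (star (pair B x))
    rw [norm_star] at h6
    nlinarith
  obtain ⟨a, b, c, d, rfl⟩ : ∃ a b c' d, c = block a b c' d := ⟨_, _, _, _, eq_block c⟩
  have hbc : b.conjTranspose = c := by
    have := isHermitian_of_mem_cone _ _ hc
    rw [Matrix.IsHermitian, block_conjTranspose] at this
    ext i j : 2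
    have := congrFun (congrFun this (Fin.natAdd n i)) (Fin.castAdd n j)
    rwa [block_right_left, block_right_left] at this
  subst hbc
  rw [hv, block_add, hp, blockSeminorm_block, ← Matrix.conjTranspose_add, matNorm_conjTranspose,
    zero_add, zero_add] at hlt
  have ha := matNorm_nonneg n a
  have hd := matNorm_nonneg n d
  have hxb := mul_nonneg hK0.le (matNorm_nonneg n (x + b))
  refine ⟨a, d, -b, ?_, by linarith, by linarith, ?_⟩
  · rw [Matrix.conjTranspose_neg]
    exact block_neg_mem_cone hc
  · rw [sub_neg_eq_add]
    -- Both off-diagonal blocks of the seminorm equal ‖x + b‖, which gives the factor 1/2 for y =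
    -- -b.
    have : K * (2 * matNorm n (x + b)) < K * matNorm n x := by linarith
    have := lt_of_mul_lt_mul_left this hK0.le
    linarith

open Filter Topology in
theorem exists_tendsto_sum [CompleteSpace V] {n : ℕ} (a : ℕ → Matrix (Fin n) (Fin n) V) {C : ℝ}
    (ha : ∀ i, matNorm n (a i) ≤ C * (1 / 2) ^ i) : ∃ S : Matrix (Fin n) (Fin n) V,
      matNorm n S ≤ C * 2 ∧
        Tendsto (fun N => matNorm n (S - ∑ i ∈ Finset.range N, a i)) atTop (𝓝 0) := by
  have hgeo : HasSum (fun i : ℕ => C * (1 / 2 : ℝ) ^ i) (C * 2) := hasSum_geometric_two.mul_left C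
  have hsum : ∀ p q, Summable fun i => a i p q := fun p q =>
    Summable.of_norm_bounded hgeo.summable fun i => (norm_entry_le (a i) p q).trans (ha i)
  let S : Matrix (Fin n) (Fin n) V := Matrix.of fun p q => ∑' i, a i p q
  have hlim : Tendsto (fun N => matNorm n (S - ∑ i ∈ Finset.range N, a i)) atTop (𝓝 0) := by
    refine squeeze_zero (fun N => matNorm_nonneg n _) (fun N => matNorm_le_sum_norm _) ?_
    have : Tendsto (fun N => ∑ p, ∑ q, ‖S p q - ∑ i ∈ Finset.range N, a i p q‖) atTop
        (𝓝 (∑ p : Fin n, ∑ q : Fin n, ‖S p q - S p q‖)) := by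
      refine tendsto_finsetSum _ fun p _ => tendsto_finsetSum _ fun q _ => ?_
      exact (tendsto_const_nhds.sub (hsum p q).hasSum.tendsto_sum_nat).norm
    simpa [Matrix.sum_apply] using this
  refine ⟨S, ?_, hlim⟩
  have hC : 0 ≤ C := by
    have := (matNorm_nonneg n (a 0)).trans (ha 0)
    simpa using this
  have h1 : Tendsto (fun N => matNorm n (S - ∑ i ∈ Finset.range N, a i) + C * 2) atTop
      (𝓝 (0 + C * 2)) := hlim.add_const _
  rw [zero_add] at h1
  refine ge_of_tendsto' h1 fun N => ?_
  have h2 := matNorm_add_le n (S - ∑ i ∈ Finset.range N, a i) (∑ i ∈ Finset.range N, a i)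
  rw [sub_add_cancel] at h2
  refine h2.trans (add_le_add_right ((matNorm_sum_le _ _).trans ?_) _)
  refine (Finset.sum_le_sum fun i _ => ha i).trans ?_
  exact sum_le_hasSum _ (fun i _ => by positivity) hgeo

open Filter Topology in
theorem IsNormal.isGenerating [CompleteSpace V] {k : ℝ} (hk : 0 ≤ k) (h : IsNormal (OpDual V) k) :
    IsGenerating V ((8 * k + 1) * 2) := by
  intro n x
  choose A B Y hcone hA hB hY using fun x => h.exists_approx hk (n := n) x
  set K := 8 * k + 1 with hK
  have hK0 : 0 < K := by positivity
  -- The residuals of successive approximation; each has at most half the norm of the one before.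
  let r : ℕ → Matrix (Fin n) (Fin n) V := fun i => Nat.rec x (fun _ y => y - Y y) i
  have hr : ∀ i, matNorm n (r i) ≤ matNorm n x * (1 / 2) ^ i := fun i => by
    induction i with
    | zero => simp [r]
    | succ i ih =>
      refine (hY (r i)).trans ?_
      rw [pow_succ]
      linarith
  have hbound : ∀ (Z : Matrix (Fin n) (Fin n) V → Matrix (Fin n) (Fin n) V),
      (∀ y, matNorm n (Z y) ≤ K * matNorm n y) →
      ∀ i, matNorm n (Z (r i)) ≤ K * matNorm n x * (1 / 2) ^ i := fun Z hZ i => by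
    refine (hZ _).trans ?_
    rw [mul_assoc]
    exact mul_le_mul_of_nonneg_left (hr i) hK0.le
  obtain ⟨a, ha, hla⟩ := exists_tendsto_sum (fun i => A (r i)) (hbound A hA)
  obtain ⟨b, hb, hlb⟩ := exists_tendsto_sum (fun i => B (r i)) (hbound B hB)
  refine ⟨a, b, ?_, by linarith, by linarith⟩
  -- The corners Y(r_i) telescope to x - r_N.
  have hpart : ∀ N, block (∑ i ∈ Finset.range N, A (r i)) (x - r N) (x - r N).conjTranspose
      (∑ i ∈ Finset.range N, B (r i)) ∈ cone (n + n) := fun N => by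
    induction N with
    | zero => simpa [r, block_zero] using zero_mem_cone (n + n)
    | succ N ih =>
      have := add_mem_cone _ _ _ ih (hcone (r N))
      rw [block_add, ← Matrix.conjTranspose_add] at this
      have e : x - r N + Y (r N) = x - r (N + 1) := by
        change _ = x - (r N - Y (r N))
        abel
      rwa [e, ← Finset.sum_range_succ (fun i => A (r i)),
        ← Finset.sum_range_succ (fun i => B (r i))] at this
  refine cone_closed _ _ fun ε hε => ?_
  have hlr : Tendsto (fun N => matNorm n (r N)) atTop (𝓝 0) := by
    refine squeeze_zero (fun N => matNorm_nonneg n _) hr ?_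
    have := (tendsto_pow_atTop_nhds_zero_of_lt_one (r := (1 / 2 : ℝ)) (by norm_num)
      (by norm_num)).const_mul (matNorm n x)
    simpa using this
  have htot := (hla.max hlb).add hlr
  rw [max_self, zero_add] at htot
  obtain ⟨N, hN⟩ := ((tendsto_order.mp htot).2 ε hε).exists
  refine ⟨_, hpart N, lt_of_le_of_lt ?_ hN⟩
  rw [block_sub, ← Matrix.conjTranspose_sub, sub_sub_cancel]
  refine (matNorm_block_le _ _ _ _).trans ?_
  rw [matNorm_conjTranspose, max_self]

end Generation

/-! ### The gauge of dominated matrices. -/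

section RegularNorm

variable {V : Type*} [NormedAddCommGroup V] [NormedSpace ℂ V] [StarAddMonoid V]
  [StarModule ℂ V] [MatrixOrderedOperatorSpace V]

/-- `x` is the corner of a positive matrix `(a x; x^* b)` with diagonal bounded by `t`. -/
def IsDominated {n : ℕ} (x : Matrix (Fin n) (Fin n) V) (t : ℝ) : Prop :=
  ∃ a b : Matrix (Fin n) (Fin n) V, block a x x.conjTranspose b ∈ cone (n + n) ∧
    matNorm n a ≤ t ∧ matNorm n b ≤ t

/-- The gauge of the matrices that are dominated by `1`. -/
def regNorm (n : ℕ) (x : Matrix (Fin n) (Fin n) V) : ℝ :=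
  sInf {t | IsDominated x t}

theorem IsDominated.nonneg {n : ℕ} {x : Matrix (Fin n) (Fin n) V} {t : ℝ} (h : IsDominated x t) :
    0 ≤ t := by
  obtain ⟨a, b, -, ha, -⟩ := h
  exact (matNorm_nonneg n a).trans ha

theorem IsDominated.mono {n : ℕ} {x : Matrix (Fin n) (Fin n) V} {s t : ℝ} (h : IsDominated x s)
    (hst : s ≤ t) : IsDominated x t := by
  obtain ⟨a, b, hab, ha, hb⟩ := h
  exact ⟨a, b, hab, ha.trans hst, hb.trans hst⟩

theorem IsDominated.regNorm_le {n : ℕ} {x : Matrix (Fin n) (Fin n) V} {t : ℝ}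
    (h : IsDominated x t) : regNorm n x ≤ t :=
  csInf_le ⟨0, fun _ hs => hs.nonneg⟩ h

theorem regNorm_nonneg (n : ℕ) (x : Matrix (Fin n) (Fin n) V) : 0 ≤ regNorm n x :=
  Real.sInf_nonneg fun _ h => h.nonneg

theorem isDominated_zero (n : ℕ) : IsDominated (0 : Matrix (Fin n) (Fin n) V) 0 :=
  ⟨0, 0, by simpa [block_zero] using zero_mem_cone (n + n), by simp [matNorm_zero]⟩

theorem IsDominated.add {n : ℕ} {x y : Matrix (Fin n) (Fin n) V} {s t : ℝ} (hx : IsDominated x s)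
    (hy : IsDominated y t) : IsDominated (x + y) (s + t) := by
  obtain ⟨a, b, hab, ha, hb⟩ := hx
  obtain ⟨c, d, hcd, hc, hd⟩ := hy
  refine ⟨a + c, b + d, ?_, (matNorm_add_le _ _ _).trans (add_le_add ha hc),
    (matNorm_add_le _ _ _).trans (add_le_add hb hd)⟩
  rw [Matrix.conjTranspose_add, ← block_add]
  exact add_mem_cone _ _ _ hab hcd

theorem IsDominated.conjTranspose {n : ℕ} {x : Matrix (Fin n) (Fin n) V} {t : ℝ}
    (h : IsDominated x t) : IsDominated x.conjTranspose t := by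
  obtain ⟨a, b, hab, ha, hb⟩ := h
  refine ⟨b, a, ?_, hb, ha⟩
  rw [Matrix.conjTranspose_conjTranspose]
  exact block_swap_mem_cone hab

theorem IsDominated.scalarMul_of_le {m n : ℕ} {x : Matrix (Fin m) (Fin m) V} {t c : ℝ}
    (h : IsDominated x t) {α : Matrix (Fin n) (Fin m) ℂ} {β : Matrix (Fin m) (Fin n) ℂ}
    (hα : ‖α‖ ^ 2 ≤ c) (hβ : ‖β‖ ^ 2 ≤ c) : IsDominated (scalarMul α x β) (c * t) := by
  have ht := h.nonneg
  obtain ⟨a, b, hab, ha, hb⟩ := h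
  have h1 := block_dsum_mem_cone α β.conjTranspose hab
  rw [← Matrix.conjTranspose_conjTranspose β, Matrix.conjTranspose_conjTranspose β.conjTranspose,
    ← conjTranspose_scalarMul, Matrix.conjTranspose_conjTranspose] at h1
  have bound : ∀ (δ : Matrix (Fin n) (Fin m) ℂ) (z : Matrix (Fin m) (Fin m) V),
      ‖δ‖ ^ 2 ≤ c → matNorm m z ≤ t → matNorm n (scalarMul δ z δ.conjTranspose) ≤ c * t :=
    fun δ z hδ hz => by
    refine (matNorm_scalarMul_le _ _ _ _ _).trans ?_
    rw [Matrix.l2_opNorm_conjTranspose]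
    calc ‖δ‖ * matNorm m z * ‖δ‖ = ‖δ‖ ^ 2 * matNorm m z := by ring
      _ ≤ c * t := mul_le_mul hδ hz (matNorm_nonneg _ _) ((sq_nonneg _).trans hδ)
  refine ⟨_, _, h1, bound α a hα ha, ?_⟩
  have := bound β.conjTranspose b (by rwa [Matrix.l2_opNorm_conjTranspose]) hb
  rwa [Matrix.conjTranspose_conjTranspose] at this

theorem IsDominated.scalarMul {m n : ℕ} {x : Matrix (Fin m) (Fin m) V} {t : ℝ}
    (h : IsDominated x t) (α : Matrix (Fin n) (Fin m) ℂ) (β : Matrix (Fin m) (Fin n) ℂ) :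
    IsDominated (scalarMul α x β) (‖α‖ * t * ‖β‖) := by
  rcases (norm_nonneg α).eq_or_lt with hα | hα
  · rw [← hα, norm_eq_zero.mp hα.symm, zero_scalarMul, zero_mul, zero_mul]
    exact isDominated_zero n
  rcases (norm_nonneg β).eq_or_lt with hβ | hβ
  · rw [← hβ, norm_eq_zero.mp hβ.symm, scalarMul_zero_right, mul_zero]
    exact isDominated_zero n
  -- The diagonal becomes α a α^* and β^* b β, of sizes ‖α‖² and ‖β‖². Rescaling by s balances them
  -- at ‖α‖‖β‖ without changing α x β.
  let s : ℝ := √(‖β‖ / ‖α‖)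
  have hs : 0 < s := Real.sqrt_pos.mpr (div_pos hβ hα)
  have hs2 : s ^ 2 = ‖β‖ / ‖α‖ := Real.sq_sqrt (div_pos hβ hα).le
  have e : MatOrd.scalarMul ((s : ℂ) • α) x (((s⁻¹ : ℝ) : ℂ) • β) = MatOrd.scalarMul α x β := by
    rw [smul_scalarMul, scalarMul_smul_right, smul_smul, ← Complex.ofReal_mul,
      mul_inv_cancel₀ hs.ne', Complex.ofReal_one, one_smul]
  have h1 := h.scalarMul_of_le (α := (s : ℂ) • α) (β := ((s⁻¹ : ℝ) : ℂ) • β) (c := ‖α‖ * ‖β‖)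
    (by
      rw [norm_smul, Complex.norm_real, Real.norm_of_nonneg hs.le, mul_pow, hs2]
      field_simp
      exact le_rfl)
    (by
      rw [norm_smul, Complex.norm_real, Real.norm_of_nonneg (by positivity), mul_pow, inv_pow, hs2]
      field_simp
      exact le_rfl)
  rw [e] at h1
  convert h1 using 1
  ring

/-- Up to reordering of indices, the direct sum of the two dominating blocks; it is built as a sum
of two embedded blocks. -/
theorem IsDominated.directSum {m n : ℕ} {x : Matrix (Fin m) (Fin m) V}
    {y : Matrix (Fin n) (Fin n) V} {t : ℝ} (hx : IsDominated x t) (hy : IsDominated y t) :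
    IsDominated (block x 0 0 y) t := by
  obtain ⟨a, b, hab, ha, hb⟩ := hx
  obtain ⟨c, d, hcd, hc, hd⟩ := hy
  refine ⟨block a 0 0 c, block b 0 0 d, ?_, ?_, ?_⟩
  · have h1 := block_dsum_mem_cone (sel (Fin.castAdd n)) (sel (Fin.castAdd n)) hab
    have h2 := block_dsum_mem_cone (sel (Fin.natAdd m)) (sel (Fin.natAdd m)) hcd
    have h3 := add_mem_cone _ _ _ h1 h2
    rw [block_add, ← block_diag_eq_add, ← block_diag_eq_add, ← block_diag_eq_add,
      ← block_diag_eq_add] at h3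
    rw [block_conjTranspose, Matrix.conjTranspose_zero, Matrix.conjTranspose_zero]
    exact h3
  · rw [matNorm_directSum]
    exact max_le ha hc
  · rw [matNorm_directSum]
    exact max_le hb hd

theorem IsNormal.matNorm_le_of_isDominated {k : ℝ} (hk : 0 ≤ k) (h : IsNormal V k) {n : ℕ}
    {x : Matrix (Fin n) (Fin n) V} {t : ℝ} (hx : IsDominated x t) : matNorm n x ≤ k * t := by
  obtain ⟨a, b, hab, ha, hb⟩ := hx
  have h1 := h n x (block a 0 0 b) (by
    convert block_neg_mem_cone hab using 1
    rw [block_sub]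
    simp)
  refine h1.trans (mul_le_mul_of_nonneg_left ?_ hk)
  rw [matNorm_directSum]
  exact max_le ha hb

theorem isDominated_of_le {n : ℕ} {u v : Matrix (Fin n) (Fin n) V} (hv : v.IsHermitian)
    (h₁ : v + u ∈ cone n) (h₂ : u - v ∈ cone n) : IsDominated v (matNorm n u) := by
  refine ⟨u, u, ?_, le_rfl, le_rfl⟩
  rw [hv.eq]
  exact block_mem_cone_of_le h₁ h₂

theorem IsDominated.exists_ge {n : ℕ} {v : Matrix (Fin n) (Fin n) V} {t : ℝ}
    (h : IsDominated v t) (hv : v.IsHermitian) :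
    ∃ u ∈ cone n, matNorm n u ≤ t ∧ v + u ∈ cone n ∧ u - v ∈ cone n := by
  obtain ⟨a, b, hab, ha, hb⟩ := h
  rw [hv.eq] at hab
  obtain ⟨h1, h2⟩ := le_of_block_mem_cone hab
  exact ⟨_, mem_cone_of_le h1 h2, matNorm_half_add_le ha hb, h1, h2⟩

theorem isDominated_self {n : ℕ} {u : Matrix (Fin n) (Fin n) V} (hu : u ∈ cone n) :
    IsDominated u (matNorm n u) :=
  isDominated_of_le (isHermitian_of_mem_cone n u hu) (add_mem_cone _ _ _ hu hu)
    (by rw [sub_self]; exact zero_mem_cone n)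

end RegularNorm

/-! ### The matrix regular renorming. -/

section Renorming

variable (V : Type*) [NormedAddCommGroup V] [NormedSpace ℂ V] [StarAddMonoid V]
  [StarModule ℂ V] [MatrixOrderedOperatorSpace V]

/-- The order is normal and generating. -/
structure IsRegularizable : Prop where
  normal : ∃ k : ℝ, 0 < k ∧ IsNormal V k
  generating : ∃ K : ℝ, 0 ≤ K ∧ IsGenerating V K

variable {V}

/-- Generation makes the set defining `regNorm` nonempty. For an empty set the infimum would take
the default value 0 and say nothing. -/
theorem IsRegularizable.isDominated (h : IsRegularizable V) {n : ℕ} {x : Matrix (Fin n) (Fin n) V}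
    {t : ℝ} (ht : regNorm n x < t) : IsDominated x t := by
  obtain ⟨K, -, hK⟩ := h.generating
  obtain ⟨s, hs, hst⟩ := exists_lt_of_csInf_lt (s := {t | IsDominated x t}) ⟨_, hK n x⟩ ht
  exact IsDominated.mono hs hst.le

theorem IsRegularizable.le_regNorm (h : IsRegularizable V) {n : ℕ} {x : Matrix (Fin n) (Fin n) V}
    {s : ℝ} (hs : ∀ t, IsDominated x t → s ≤ t) : s ≤ regNorm n x := by
  obtain ⟨K, -, hK⟩ := h.generating
  exact le_csInf ⟨_, hK n x⟩ hs

theorem IsRegularizable.regNorm_add_le (h : IsRegularizable V) {n : ℕ}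
    (x y : Matrix (Fin n) (Fin n) V) : regNorm n (x + y) ≤ regNorm n x + regNorm n y := by
  rw [← sub_le_iff_le_add]
  refine h.le_regNorm fun s hs => ?_
  rw [sub_le_comm]
  refine h.le_regNorm fun t ht => ?_
  rw [sub_le_iff_le_add]
  exact (hs.add ht).regNorm_le.trans (add_comm s t).le

theorem IsRegularizable.regNorm_scalarMul_le (h : IsRegularizable V) {m n : ℕ}
    (α : Matrix (Fin n) (Fin m) ℂ) (x : Matrix (Fin m) (Fin m) V) (β : Matrix (Fin m) (Fin n) ℂ) :
    regNorm n (scalarMul α x β) ≤ ‖α‖ * regNorm m x * ‖β‖ := by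
  refine le_of_forall_pos_le_add fun ε hε => ?_
  -- The summand 1 keeps the divisor positive when α or β vanishes.
  have hc : 0 < ‖α‖ * ‖β‖ + 1 := by positivity
  have h1 : regNorm m x < regNorm m x + ε / (‖α‖ * ‖β‖ + 1) := by
    have : 0 < ε / (‖α‖ * ‖β‖ + 1) := by positivity
    linarith
  refine ((h.isDominated h1).scalarMul α β).regNorm_le.trans ?_
  have h2 : ‖α‖ * ‖β‖ * (ε / (‖α‖ * ‖β‖ + 1)) ≤ ε := by
    rw [mul_div_assoc', div_le_iff₀ hc]
    nlinarith
  calc _ = ‖α‖ * regNorm m x * ‖β‖ + ‖α‖ * ‖β‖ * (ε / (‖α‖ * ‖β‖ + 1)) := by ring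
    _ ≤ _ := by gcongr

theorem IsRegularizable.regNorm_smul (h : IsRegularizable V) {n : ℕ} (c : ℂ)
    (x : Matrix (Fin n) (Fin n) V) : regNorm n (c • x) = ‖c‖ * regNorm n x := by
  have key : ∀ (c : ℂ) (x : Matrix (Fin n) (Fin n) V), regNorm n (c • x) ≤ ‖c‖ * regNorm n x :=
    fun c x => by
    have h1 := h.regNorm_scalarMul_le (c • (1 : Matrix (Fin n) (Fin n) ℂ)) x 1
    rw [smul_scalarMul, one_scalarMul_one] at h1
    have h2 : ‖(1 : Matrix (Fin n) (Fin n) ℂ)‖ ≤ 1 := norm_le_one_of_isometry 1 (by simp)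
    have hx := regNorm_nonneg n x
    refine h1.trans ?_
    rw [norm_smul]
    calc _ ≤ ‖c‖ * 1 * regNorm n x * 1 := by gcongr
      _ = _ := by ring
  refine le_antisymm (key c x) ?_
  rcases eq_or_ne c 0 with rfl | hc
  · rw [norm_zero, zero_mul]
    exact regNorm_nonneg n _
  · have h1 := key c⁻¹ (c • x)
    rw [smul_smul, inv_mul_cancel₀ hc, one_smul, norm_inv] at h1
    rwa [← le_inv_mul_iff₀ (norm_pos_iff.mpr hc)]

theorem IsNormal.matNorm_le_regNorm (h : IsRegularizable V) {k : ℝ} (hk : 0 < k)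
    (hN : IsNormal V k) {n : ℕ} (x : Matrix (Fin n) (Fin n) V) :
    matNorm n x ≤ k * regNorm n x := by
  rw [← div_le_iff₀' hk]
  refine h.le_regNorm fun t ht => ?_
  rw [div_le_iff₀' hk]
  exact hN.matNorm_le_of_isDominated hk.le ht

theorem IsGenerating.regNorm_le {K : ℝ} (hG : IsGenerating V K) {n : ℕ}
    (x : Matrix (Fin n) (Fin n) V) : regNorm n x ≤ K * matNorm n x :=
  IsDominated.regNorm_le (hG n x)

theorem IsRegularizable.eq_zero (h : IsRegularizable V) {n : ℕ} {x : Matrix (Fin n) (Fin n) V}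
    (hx : regNorm n x = 0) : x = 0 := by
  obtain ⟨k, hk, hN⟩ := h.normal
  have h1 := hN.matNorm_le_regNorm h hk x
  rw [hx, mul_zero] at h1
  exact eq_zero_of_matNorm n x (le_antisymm h1 (matNorm_nonneg n x))

theorem IsRegularizable.regNorm_submatrix_le (h : IsRegularizable V) {m n : ℕ} {f : Fin n → Fin m}
    (hf : Function.Injective f) (x : Matrix (Fin m) (Fin m) V) :
    regNorm n (x.submatrix f f) ≤ regNorm m x := by
  rw [← scalarMul_sel]
  refine (h.regNorm_scalarMul_le _ _ _).trans ?_
  rw [Matrix.l2_opNorm_conjTranspose]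
  have h0 := regNorm_nonneg m x
  have h1 := norm_sel_le hf
  calc ‖sel f‖ * regNorm m x * ‖sel f‖ ≤ 1 * regNorm m x * 1 := by gcongr
    _ = regNorm m x := by ring

theorem IsRegularizable.regNorm_directSum (h : IsRegularizable V) {m n : ℕ}
    (x : Matrix (Fin m) (Fin m) V) (y : Matrix (Fin n) (Fin n) V) :
    regNorm (m + n) (block x 0 0 y) = max (regNorm m x) (regNorm n y) := by
  refine le_antisymm (le_of_forall_gt_imp_ge_of_dense fun t ht => ?_) (max_le ?_ ?_)
  · exact ((h.isDominated ((le_max_left _ _).trans_lt ht)).directSum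
      (h.isDominated ((le_max_right _ _).trans_lt ht))).regNorm_le
  · have e : x = (block x 0 0 y).submatrix (Fin.castAdd n) (Fin.castAdd n) := by ext; simp
    conv_lhs => rw [e]
    exact h.regNorm_submatrix_le (Fin.castAdd_injective m n) _
  · have e : y = (block x 0 0 y).submatrix (Fin.natAdd m) (Fin.natAdd m) := by ext; simp
    conv_lhs => rw [e]
    exact h.regNorm_submatrix_le (Fin.natAdd_injective n m) _

theorem IsRegularizable.regNorm_conjTranspose (h : IsRegularizable V) {n : ℕ}
    (x : Matrix (Fin n) (Fin n) V) : regNorm n x.conjTranspose = regNorm n x := by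
  refine le_antisymm (h.le_regNorm fun t ht => ht.conjTranspose.regNorm_le)
    (h.le_regNorm fun t ht => ?_)
  have := ht.conjTranspose.regNorm_le
  rwa [Matrix.conjTranspose_conjTranspose] at this

/-- Whatever dominates u also dominates v, so v inherits every bound on the gauge of u. -/
theorem IsRegularizable.regNorm_le_regNorm (h : IsRegularizable V) {n : ℕ}
    {v u : Matrix (Fin n) (Fin n) V} (hv : v.IsHermitian) (hu : u ∈ cone n) (h₁ : v + u ∈ cone n)
    (h₂ : u - v ∈ cone n) : regNorm n v ≤ regNorm n u := by
  refine h.le_regNorm fun t ht => ?_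
  obtain ⟨w, -, hwt, h3, h4⟩ := ht.exists_ge (isHermitian_of_mem_cone n u hu)
  have h5 : v + w ∈ cone n := by
    convert add_mem_cone n _ _ h₁ h4 using 1
    abel
  have h6 : w - v ∈ cone n := by
    convert add_mem_cone n _ _ h₂ h4 using 1
    abel
  exact ((isDominated_of_le hv h5 h6).mono hwt).regNorm_le

theorem IsRegularizable.exists_regNorm_lt_one (h : IsRegularizable V) {n : ℕ}
    {v : Matrix (Fin n) (Fin n) V} (hv : v.IsHermitian) (hlt : regNorm n v < 1) :
    ∃ u ∈ cone n, regNorm n u < 1 ∧ v + u ∈ cone n ∧ u - v ∈ cone n := by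
  obtain ⟨t, ht, ht1⟩ := exists_between hlt
  obtain ⟨u, hu, hut, h1, h2⟩ := (h.isDominated ht).exists_ge hv
  -- A positive u dominates itself, so its new norm is at most its old norm.
  exact ⟨u, hu, (isDominated_self hu).regNorm_le.trans_lt (hut.trans_lt ht1), h1, h2⟩

/-- The space `V` with the norms `regNorm`. -/
def Renorm (V : Type*) [NormedAddCommGroup V] [NormedSpace ℂ V] [StarAddMonoid V]
    [StarModule ℂ V] [MatrixOrderedOperatorSpace V] (_ : IsRegularizable V) : Type _ := V

namespace Renorm

variable (h : IsRegularizable V)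

/-- The norm of `Renorm V h`. -/
def groupNorm : AddGroupNorm V where
  toFun v := regNorm 1 (Matrix.of fun _ _ => v)
  map_zero' := le_antisymm (isDominated_zero 1).regNorm_le (regNorm_nonneg 1 _)
  add_le' v w := h.regNorm_add_le (Matrix.of fun _ _ => v) (Matrix.of fun _ _ => w)
  neg' v := by
    have := h.regNorm_smul (-1) (Matrix.of fun _ _ => v : Matrix (Fin 1) (Fin 1) V)
    rw [norm_neg, norm_one, one_mul, neg_one_smul] at this
    exact this
  eq_zero_of_map_eq_zero' v hv := congrFun (congrFun (h.eq_zero hv) 0) 0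

instance : NormedAddCommGroup (Renorm V h) :=
  @AddGroupNorm.toNormedAddCommGroup V _ (groupNorm h)

instance : NormedSpace ℂ (Renorm V h) where
  toModule := inferInstanceAs (Module ℂ V)
  norm_smul_le c v := (h.regNorm_smul c (Matrix.of fun _ _ => v : Matrix (Fin 1) (Fin 1) V)).le

instance : StarAddMonoid (Renorm V h) := inferInstanceAs (StarAddMonoid V)

instance : StarModule ℂ (Renorm V h) := inferInstanceAs (StarModule ℂ V)

instance : MatrixOrderedOperatorSpace (Renorm V h) where
  matNorm n := regNorm (V := V) n
  matNorm_add_le n := h.regNorm_add_le (n := n)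
  matNorm_smul n := h.regNorm_smul (n := n)
  eq_zero_of_matNorm n x := h.eq_zero (n := n) (x := x)
  matNorm_one v := rfl
  matNorm_directSum m n := h.regNorm_directSum (m := m) (n := n)
  matNorm_scalarMul_le m n := h.regNorm_scalarMul_le (m := m) (n := n)
  cone := MatrixOrdered.cone (V := V)
  zero_mem_cone := zero_mem_cone (V := V)
  add_mem_cone := add_mem_cone (V := V)
  smul_mem_cone := smul_mem_cone (V := V)
  isHermitian_of_mem_cone := isHermitian_of_mem_cone (V := V)
  scalarMul_mem_cone := scalarMul_mem_cone (V := V)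
  matNorm_conjTranspose n := h.regNorm_conjTranspose (n := n)
  cone_closed n x hx := by
    obtain ⟨k, hk, hN⟩ := h.normal
    refine cone_closed (V := V) n x fun ε hε => ?_
    obtain ⟨y, hy, hxy⟩ := hx (ε / k) (div_pos hε hk)
    refine ⟨y, hy, (hN.matNorm_le_regNorm h hk _).trans_lt ?_⟩
    rwa [lt_div_iff₀' hk] at hxy

/-- The identity map from `V` to `Renorm V h`. -/
def equiv : V ≃ₗ[ℂ] Renorm V h := LinearEquiv.refl ℂ V

theorem isCompleteOrderIso_equiv : IsCompleteOrderIso (equiv h) where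
  cb := by
    obtain ⟨K, -, hK⟩ := h.generating
    exact ⟨K, fun n x => hK.regNorm_le x⟩
  cb_symm := by
    obtain ⟨k, hk, hN⟩ := h.normal
    exact ⟨k, fun n x => hN.matNorm_le_regNorm h hk x⟩
  cp := ⟨fun _ => rfl, fun _ _ hx => hx⟩
  cp_symm := ⟨fun _ => rfl, fun _ _ hx => hx⟩

theorem completeSpace [CompleteSpace V] : CompleteSpace (Renorm V h) := by
  obtain ⟨k, hk, hN⟩ := h.normal
  obtain ⟨K, -, hK⟩ := h.generating
  let e : V ≃L[ℂ] Renorm V h := (equiv h).toContinuousLinearEquivOfBounds K k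
    (fun v => by
      have := hK.regNorm_le (Matrix.of fun _ _ => v : Matrix (Fin 1) (Fin 1) V)
      rwa [matNorm_one] at this)
    (fun v => by
      have := hN.matNorm_le_regNorm h hk
        (Matrix.of fun _ _ => (equiv h).symm v : Matrix (Fin 1) (Fin 1) V)
      rwa [matNorm_one] at this)
  exact (completeSpace_congr (e := e.toEquiv) e.isUniformEmbedding).mp inferInstance

theorem isMatrixRegular [CompleteSpace V] : IsMatrixRegular (Renorm V h) where
  complete := completeSpace h
  norm_le n _ _ hv hu h₁ h₂ := h.regNorm_le_regNorm (n := n) hv hu h₁ h₂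
  exists_bound n _ hv hlt := h.exists_regNorm_lt_one (n := n) hv hlt

end Renorm

end Renorming

end MatOrd

end

theorem mainTheorem1 (V : Type u) [NormedAddCommGroup V] [NormedSpace ℂ V] [StarAddMonoid V]
    [StarModule ℂ V] [MatOrd.MatrixOrderedOperatorSpace V] [CompleteSpace V] :
    (∃ (W : Type u) (_ : NormedAddCommGroup W) (_ : NormedSpace ℂ W) (_ : StarAddMonoid W)
        (_ : StarModule ℂ W) (_ : MatOrd.MatrixOrderedOperatorSpace W),
        MatOrd.IsMatrixRegular W ∧ ∃ Φ : V ≃ₗ[ℂ] W, MatOrd.IsCompleteOrderIso Φ) ↔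
      MatOrd.IsOperatorSystem V ∧ MatOrd.IsOperatorSystem (MatOrd.OpDual V) := by
  constructor
  · rintro ⟨W, _, _, _, _, _, hW, Φ, hΦ⟩
    exact hΦ.isOperatorSystem hW
  · rintro ⟨hV, hV'⟩
    obtain ⟨k, hk, hN⟩ := MatOrd.isOperatorSystem_iff.mp hV'
    have h : MatOrd.IsRegularizable V :=
      ⟨MatOrd.isOperatorSystem_iff.mp hV, _, by positivity, hN.isGenerating hk.le⟩
    exact ⟨MatOrd.Renorm V h, inferInstance, inferInstance, inferInstance, inferInstance,
      inferInstance, MatOrd.Renorm.isMatrixRegular h, MatOrd.Renorm.equiv h,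
      MatOrd.Renorm.isCompleteOrderIso_equiv h⟩
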